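/- Let $d\ge 3$, let $n_1,\dots,n_d\ge 2$ be integers, and let $r\ge 0$ be an integer with $r\le n_i$ for every $i$. The Lie group $G=\mathrm{GL}(n_1)\times\dots\times\mathrm{GL}(n_d)$ of real invertible matrices acts on $\mathbb{R}^{n_1}\otimes\dots\otimes\mathbb{R}^{n_d}$ by $(g_1,\dots,g_d)\cdot(v_1\otimes\dots\otimes v_d)=(g_1v_1)\otimes\dots\otimes(g_dv_d)$. The CP rank of a tensor $T$ is the smallest $s$ such that $T$ is a sum of $s$ tensors of the form $v_1\otimes\dots\otimes v_d$; the multilinear rank of $T$ is the tuple $(t_1,\dots,t_d)$, where $t_i$ is the rank of $T$ regarded as a linear map from $\mathbb{R}^{n_i}$ to the tensor product of the other factors. Let $\operatorname{rank}^{-1}(r)$ be the set of tensors of CP rank $r$, let $\Sigma_r\subseteq\operatorname{rank}^{-1}(r)$ be the set of tensors of CP rank $r$ and multilinear rank $(r,\dots,r)$, and put $T_0=\sum_{j=1}^r e_1^j\otimes\dots\otimes e_d^j$, where $e_i^1,\dots,e_i^{n_i}$ is the standard basis of $\mathbb{R}^{n_i}$. Then: 1. $\Sigma_r$ is a single orbit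 of $G$, namely $\Sigma_r=G\cdot T_0$. 2. $\Sigma_r$ is open and dense in $\operatorname{rank}^{-1}(r)$ for the Euclidean topology; it is also relatively Zariski open in $\operatorname{rank}^{-1}(r)$, that is, there is a set $P$ of real polynomials in the tensor entries such that $\Sigma_r$ is the set of those $T\in\operatorname{rank}^{-1}(r)$ with $p(T)\ne 0$ for some $p\in P$. 3. The stabilizer $H$ of $T_0$ in $G$ is exactly the set of all $(h_1,\dots,h_d)$ of the form $$h_i=\begin{bmatrix} D_iQ & M_i\\ 0 & A_i\end{bmatrix},\qquad i=1,\dots,d,$$ where the $D_i$ are invertible diagonal $r\times r$ matrices with $D_1\cdots D_d=1$, $Q$ is an $r\times r$ permutation matrix (the same for all $i$), $A_i$ is an arbitrary invertible $(n_i-r)\times(n_i-r)$ matrix, and $M_i$ is an arbitrary $r\times(n_i-r)$ matrix. 4. $\Sigma_r$ is the smooth homogeneous manifold $G/H$: the quotient space $G/H$ carries a structure of smooth manifold of some finite dimension for which the action of $G$ on $G/H$ is smooth, the projection $\pi\colon G\to G/H$ is a smooth submersion, a function $f\colon G/H\to\mathbb{R}$ is smooth if and only if $f\circ\pi$ is smooth,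 and the map $gH\mapsto g\cdot T_0$ is a smooth embedding of $G/H$ into $\mathbb{R}^{n_1}\otimes\dots\otimes\mathbb{R}^{n_d}$ with image $\Sigma_r$. -/

import Mathlib

open scoped Manifold ContDiff

noncomputable section

namespace CPTensor

variable {d : ℕ}

/-- Real tensors of format `n 0 × ⋯ × n (d - 1)`, i.e. elements of
`ℝ^(n 0) ⊗ ⋯ ⊗ ℝ^(n (d - 1))`, given by their coordinates in the standard basis
(see `tensorEquiv` for the identification with the abstract tensor product). -/
abbrev Tensor (n : Fin d → ℕ) : Type := (∀ i, Fin (n i)) → ℝ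

/-- The rank-one tensor `v 0 ⊗ ⋯ ⊗ v (d - 1)`. -/
def outer {n : Fin d → ℕ} (v : ∀ i, Fin (n i) → ℝ) : Tensor n :=
  fun k => ∏ i, v i (k i)

/-- The identification of the abstract tensor product with arrays of coordinates. -/
def tensorEquiv (n : Fin d → ℕ) :
    (PiTensorProduct ℝ fun i => (Fin (n i) → ℝ)) ≃ₗ[ℝ] Tensor n :=
  (Basis.piTensorProduct fun i => Pi.basisFun ℝ (Fin (n i))).equivFun

theorem tensorEquiv_tprod {n : Fin d → ℕ} (v : ∀ i, Fin (n i) → ℝ) :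
    tensorEquiv n (PiTensorProduct.tprod ℝ v) = outer v := by
  funext k
  simp [tensorEquiv, outer]

/-- The algebra of families of square matrices of sizes `n 0, …, n (d - 1)`. -/
def MatAlg (n : Fin d → ℕ) : Type := ∀ i, Matrix (Fin (n i)) (Fin (n i)) ℝ

section

attribute [local instance] Matrix.linftyOpNormedRing Matrix.linftyOpNormedAlgebra

/-- `MatAlg n` as a normed ring. The norm only serves to describe the usual topology and smooth
structure of this finite-dimensional vector space, which do not depend on its choice. -/
instance (n : Fin d → ℕ) : NormedRing (MatAlg n) :=
  inferInstanceAs (NormedRing (∀ i, Matrix (Fin (n i)) (Fin (n i)) ℝ))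

instance (n : Fin d → ℕ) : NormedAlgebra ℝ (MatAlg n) :=
  inferInstanceAs (NormedAlgebra ℝ (∀ i, Matrix (Fin (n i)) (Fin (n i)) ℝ))

instance (n : Fin d → ℕ) : FiniteDimensional ℝ (MatAlg n) :=
  inferInstanceAs (FiniteDimensional ℝ (∀ i, Matrix (Fin (n i)) (Fin (n i)) ℝ))

instance (n : Fin d → ℕ) : CompleteSpace (MatAlg n) := FiniteDimensional.complete ℝ _

end

/-- The Lie group `G = GL(n 0) × ⋯ × GL(n (d - 1))`, as the group of units of the product of the
matrix algebras (a unit of a product is a family of units, see `equivProdGL`). In this form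
Mathlib equips it with its standard Lie group structure, as an open subset of the vector space of
all families of matrices. -/
abbrev G (n : Fin d → ℕ) : Type := (MatAlg n)ˣ

/-- The identification of `G` with the product of the general linear groups. -/
def equivProdGL (n : Fin d → ℕ) : G n ≃* ∀ i, GL (Fin (n i)) ℝ :=
  MulEquiv.piUnits (M := fun i => Matrix (Fin (n i)) (Fin (n i)) ℝ)

/-- The `i`-th component of an element of `G`, as a matrix. -/
def comp {n : Fin d → ℕ} (g : G n) (i : Fin d) : Matrix (Fin (n i)) (Fin (n i)) ℝ :=
  (g : MatAlg n) i

theorem comp_one {n : Fin d → ℕ} (i : Fin d) : comp (1 : G n) i = 1 := rfl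

theorem comp_mul {n : Fin d → ℕ} (g h : G n) (i : Fin d) :
    comp (g * h) i = comp g i * comp h i := rfl

theorem coe_equivProdGL {n : Fin d → ℕ} (g : G n) (i : Fin d) :
    (equivProdGL n g i : Matrix (Fin (n i)) (Fin (n i)) ℝ) = comp g i := rfl

/-- The multilinear action of `G` on tensors. -/
instance {n : Fin d → ℕ} : MulAction (G n) (Tensor n) where
  smul g T := fun k => ∑ l : (∀ i, Fin (n i)), (∏ i, comp g i (k i) (l i)) * T l
  one_smul T := by
    funext k
    change ∑ l : (∀ i, Fin (n i)), (∏ i, comp (1 : G n) i (k i) (l i)) * T l = T k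
    have h : ∀ l : (∀ i, Fin (n i)),
        (∏ i, comp (1 : G n) i (k i) (l i)) = if k = l then 1 else 0 := by
      intro l
      simp [comp_one, Matrix.one_apply, Fintype.prod_ite_zero, funext_iff]
    simp [h]
  mul_smul g h T := by
    funext k
    change ∑ l : (∀ i, Fin (n i)), (∏ i, comp (g * h) i (k i) (l i)) * T l =
      ∑ m : (∀ i, Fin (n i)), (∏ i, comp g i (k i) (m i)) *
        ∑ l : (∀ i, Fin (n i)), (∏ i, comp h i (m i) (l i)) * T l
    have e : ∀ l : (∀ i, Fin (n i)), (∏ i, comp (g * h) i (k i) (l i)) =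
        ∑ m : (∀ i, Fin (n i)),
          (∏ i, comp g i (k i) (m i)) * ∏ i, comp h i (m i) (l i) := by
      intro l
      simp only [comp_mul, Matrix.mul_apply, Finset.prod_univ_sum,
        Fintype.piFinset_univ, Finset.prod_mul_distrib]
    simp only [e, Finset.sum_mul, Finset.mul_sum]
    rw [Finset.sum_comm]
    simp only [mul_assoc]

theorem smul_apply {n : Fin d → ℕ} (g : G n) (T : Tensor n) (k : ∀ i, Fin (n i)) :
    (g • T) k = ∑ l : (∀ i, Fin (n i)), (∏ i, comp g i (k i) (l i)) * T l := rfl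

/-- The action is the one determined by
`(g_1, …, g_d) • (v_1 ⊗ ⋯ ⊗ v_d) = (g_1 v_1) ⊗ ⋯ ⊗ (g_d v_d)`. -/
theorem smul_outer {n : Fin d → ℕ} (g : G n) (v : ∀ i, Fin (n i) → ℝ) :
    g • outer v = outer fun i => (comp g i).mulVec (v i) := by
  funext k
  simp only [smul_apply, outer, Matrix.mulVec, dotProduct, Finset.prod_univ_sum,
    Fintype.piFinset_univ, Finset.prod_mul_distrib]

/-- The CP rank: the smallest `r` such that `T` is a sum of `r` tensors `v_1 ⊗ ⋯ ⊗ v_d`. -/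
def cpRank {n : Fin d → ℕ} (T : Tensor n) : ℕ :=
  sInf {r : ℕ | ∃ v : Fin r → ∀ i, Fin (n i) → ℝ, T = ∑ j, outer (v j)}

/-- The `i`-th flattening: the matrix of `T` viewed as a linear map from `ℝ^(n i)` to the tensor
product of the other factors. -/
def flattening {n : Fin d → ℕ} (T : Tensor n) (i : Fin d) :
    Matrix (∀ j : {j : Fin d // j ≠ i}, Fin (n j)) (Fin (n i)) ℝ :=
  Matrix.of fun b a => T ((Equiv.piSplitAt i fun j => Fin (n j)).symm (a, b))

/-- The multilinear rank of a tensor. -/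
def multilinearRank {n : Fin d → ℕ} (T : Tensor n) : Fin d → ℕ :=
  fun i => (flattening T i).rank

/-- The set of tensors of CP rank `r`. -/
def rankSet (n : Fin d → ℕ) (r : ℕ) : Set (Tensor n) := {T | cpRank T = r}

/-- The set `Σ_r` of tensors of CP rank `r` and multilinear rank `(r, …, r)`. -/
def SigmaSet (n : Fin d → ℕ) (r : ℕ) : Set (Tensor n) :=
  {T | cpRank T = r ∧ multilinearRank T = fun _ => r}

/-- The tensor `∑_{j < r} e_1^j ⊗ ⋯ ⊗ e_d^j`, where `e_i^j` is the `j`-th standard basis vector of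
`ℝ^(n i)` (used for `r ≤ n i`). -/
def baseTensor (n : Fin d → ℕ) (r : ℕ) : Tensor n :=
  ∑ j : Fin r, outer fun i (a : Fin (n i)) => if (a : ℕ) = (j : ℕ) then (1 : ℝ) else 0

/-- The set of all families of invertible block matrices
`[[D_i Q, M_i], [0, A_i]]`, with blocks of sizes `r` and `n i - r`, where the `D_i` are invertible
diagonal matrices with `D_1 ⋯ D_d = 1`, `Q` is a permutation matrix which does not depend on `i`,
`A_i` is invertible, and `M_i` is arbitrary. -/
def blockSet {n : Fin d → ℕ} {r : ℕ} (hr : ∀ i, r ≤ n i) : Set (G n) :=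
  {h | ∃ (Q : Equiv.Perm (Fin r)) (D : Fin d → Fin r → ℝˣ)
      (M : ∀ i, Matrix (Fin r) (Fin (n i - r)) ℝ) (A : ∀ i, GL (Fin (n i - r)) ℝ),
      (∀ j, ∏ i, D i j = 1) ∧
      ∀ i, comp h i =
        Matrix.reindex (finSumFinEquiv.trans (finCongr (Nat.add_sub_of_le (hr i))))
          (finSumFinEquiv.trans (finCongr (Nat.add_sub_of_le (hr i))))
          (Matrix.fromBlocks (Matrix.diagonal (fun j => (D i j : ℝ)) * Q.permMatrix ℝ) (M i)
            0 (A i : Matrix (Fin (n i - r)) (Fin (n i - r)) ℝ))}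

/-- The stabilizer `H` of the base tensor. -/
abbrev H (n : Fin d → ℕ) (r : ℕ) : Subgroup (G n) :=
  MulAction.stabilizer (G n) (baseTensor n r)

/-- The model with corners of the Lie group `G`. -/
abbrev modelG (n : Fin d → ℕ) := 𝓘(ℝ, MatAlg n)

end CPTensor

end

/-!
For `d ≥ 3` the decomposition of a tensor of `Σ_r` into `r` rank-one tensors is unique up to order,
and it depends continuously on the tensor. The description of the stabilizer, the local slice that
makes the quotient a manifold, and the embedding property all rest on this fact.

*Orbit, openness, density.* If `T = ∑ j, v_1^j ⊗ ⋯ ⊗ v_d^j` with `r` summands has multilinear rank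
`(r, …, r)`, then in each factor the vectors `v_i^j` are linearly independent, hence the first `r`
columns of an invertible matrix, and `T` lies in the orbit of the base tensor `T₀`
(`SigmaSet_eq_orbit`). Within CP rank `r`, all flattenings have rank at most `r`, and they have rank
`r` if and only if some product of determinants of `r × r` compressions of them is nonzero
(`SigmaSet_eq_eval_ne_zero`). A small generic translation makes the vectors of a decomposition
linearly independent (`dense_preimage_SigmaSet`).

*Continuity of the decomposition* (`exists_perm_tendsto_outer`). Let `∑ j, u^j_1 ⊗ ⋯ ⊗ u^j_d` tend
to `T₀`, along any filter. Two contractions of this sum to the first two factors, weighted by the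
others so that their top `r × r` blocks tend to the identity and to a diagonal matrix with distinct
entries, have the form `U diag(α) V` and `U diag(γ) V`, where the columns of `U` are the vectors
`u^j_1`. The top parts of these vectors are thus eigenvectors of a matrix that tends to a diagonal
matrix with distinct entries, so up to order and scale they tend to the standard basis vectors;
applying the dual vectors to the tensor isolates the rank-one summands, which therefore converge.
A constant family gives uniqueness (`exists_perm_outer_eq`), and with it the stabilizer `H` of `T₀`
(`coe_H_eq_blockSet`): its elements permute the lines spanned by the first `r` basis vectors, in the
same way in each factor.

*The manifold.* The coset modulo `H` of an element `g` of `G` near `1` contains exactly one element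
near `1` in normal form: the columns after the first `r` are those of the identity, and the first
`r` diagonal entries are `1` in all factors but one. This normal form is a rational function of the
rank-one summands of `g • T₀` (`normalForm`), and the normal forms make up an open part of an affine
subspace. This gives a slice for the right action of `H` (`standardSlice`), and any slice makes the
quotient a manifold such that the projection is smooth and has smooth local sections (`Slice`,
`HasSmoothSections`). The projection is then a submersion, and smoothness on the quotient is tested
on `G`. The orbit map is an immersion because its derivative at `1` is injective on the directions
of the slice (`eq_zero_of_fderiv_sum_outer_cols`). Submersions and immersions are defined through
charts; the inverse function theorem recognises them by their derivatives
(`isSubmersionAtOfComplement_of_surjective`, `isImmersionAtOfComplement_of_injective`). Finally the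
orbit map is an embedding: if `g • T₀` tends to `T₀`, then the rank-one summands converge up to
order, hence so does their normal form, which represents the coset of `g`
(`tendsto_mk_comap_smul_baseTensor`).
-/

noncomputable section

namespace CPTensor

open Set Function Filter Topology Module

/-! ### Submersions and immersions from their derivatives -/

section InverseFunction

variable {E : Type*} [NormedAddCommGroup E] [NormedSpace ℝ E] [CompleteSpace E] {n : ℕ∞ω}

/-- The inverse function theorem, with a local inverse in the groupoid of changes of charts. -/
theorem exists_mem_contDiffGroupoid {Φ : E → E} {a : E} {f' : E ≃L[ℝ] E} {U : Set E}
    (hU : IsOpen U) (ha : a ∈ U) (hn : n ≠ 0) (hΦ : ContDiffOn ℝ n Φ U)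
    (hd : HasFDerivAt Φ (f' : E →L[ℝ] E) a) :
    ∃ e ∈ contDiffGroupoid n 𝓘(ℝ, E), a ∈ e.source ∧ e.source ⊆ U ∧ ⇑e = Φ := by
  have hat : ∀ y ∈ U, ContDiffAt ℝ n Φ y := fun y hy => hΦ.contDiffAt (hU.mem_nhds hy)
  set e₀ := (hat a ha).toOpenPartialHomeomorph Φ hd hn with he₀
  have hcont : ContinuousOn (fderiv ℝ Φ) U :=
    hΦ.continuousOn_fderiv_of_isOpen hU (ENat.one_le_iff_ne_zero_withTop.mpr hn)
  set W : Set E := U ∩ fderiv ℝ Φ ⁻¹' range ((↑) : (E ≃L[ℝ] E) → E →L[ℝ] E) with hW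
  have hWo : IsOpen W := hcont.isOpen_inter_preimage hU ContinuousLinearEquiv.isOpen
  have haW : a ∈ W := ⟨ha, f', hd.fderiv.symm⟩
  refine ⟨e₀.restrOpen W hWo, ?_, ?_, ?_, ?_⟩
  · rw [contDiffGroupoid, mem_groupoid_of_pregroupoid]
    simp only [contDiffPregroupoid, modelWithCornersSelf_coe, modelWithCornersSelf_coe_symm,
      Function.comp_id, Function.id_comp, preimage_id, range_id, inter_univ]
    constructor
    · exact hΦ.mono fun y hy => hy.2.1
    · intro y hy
      have hy' : y ∈ e₀.target := by
        have := hy.1; exact this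
      have hyW : e₀.symm y ∈ W := by
        have := hy.2; exact this
      obtain ⟨hyU, g', hg'⟩ := hyW
      refine ContDiffAt.contDiffWithinAt ?_
      change ContDiffAt ℝ n e₀.symm y
      refine e₀.contDiffAt_symm (f₀' := g') hy' ?_ (hat _ hyU)
      rw [hg']
      exact ((hat _ hyU).differentiableAt hn).hasFDerivAt
  · exact ⟨(hat a ha).mem_toOpenPartialHomeomorph_source hd hn, haW⟩
  · exact fun y hy => hy.2.1
  · rfl

end InverseFunction

section LinearNormalForm

variable {E S : Type*} [NormedAddCommGroup E] [NormedSpace ℝ E] [FiniteDimensional ℝ E]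
  [NormedAddCommGroup S] [NormedSpace ℝ S] [FiniteDimensional ℝ S]

/-- A surjective linear map is a projection up to a choice of coordinates on its source. -/
theorem exists_equiv_fst_of_surjective (D : E →L[ℝ] S) (hD : Surjective D) :
    ∃ Θ : E ≃L[ℝ] S × EuclideanSpace ℝ (Fin (finrank ℝ E - finrank ℝ S)),
      ∀ v, (Θ v).1 = D v := by
  obtain ⟨q, hq⟩ := (LinearMap.ker (D : E →ₗ[ℝ] S)).subtype.exists_leftInverse_of_injective
    (Submodule.ker_subtype _)
  have hrank := LinearMap.finrank_range_add_finrank_ker (D : E →ₗ[ℝ] S)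
  rw [LinearMap.range_eq_top.mpr hD, finrank_top] at hrank
  have hk : finrank ℝ (LinearMap.ker (D : E →ₗ[ℝ] S)) =
      finrank ℝ (EuclideanSpace ℝ (Fin (finrank ℝ E - finrank ℝ S))) := by
    rw [finrank_euclideanSpace_fin]; omega
  let κ := LinearEquiv.ofFinrankEq _ _ hk
  let Λ : E →ₗ[ℝ] S × EuclideanSpace ℝ (Fin (finrank ℝ E - finrank ℝ S)) :=
    (D : E →ₗ[ℝ] S).prod (κ.toLinearMap ∘ₗ q)
  have hinj : Injective Λ := by
    rw [← LinearMap.ker_eq_bot, LinearMap.ker_eq_bot']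
    intro v hv
    have h1 : D v = 0 := congrArg Prod.fst hv
    have h2 : κ (q v) = 0 := congrArg Prod.snd hv
    have h3 : q v = ⟨v, h1⟩ := LinearMap.congr_fun hq ⟨v, h1⟩
    rw [h3, LinearEquiv.map_eq_zero_iff] at h2
    exact congrArg Subtype.val h2
  have hdim : finrank ℝ E =
      finrank ℝ (S × EuclideanSpace ℝ (Fin (finrank ℝ E - finrank ℝ S))) := by
    rw [finrank_prod, finrank_euclideanSpace_fin]; omega
  exact ⟨(LinearEquiv.ofInjectiveOfFinrankEq Λ hinj hdim).toContinuousLinearEquiv, fun v => rfl⟩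

/-- An injective linear map is an inclusion up to a choice of coordinates on its target. -/
theorem exists_equiv_inl_of_injective (D : S →L[ℝ] E) (hD : Injective D) :
    ∃ Θ : (S × EuclideanSpace ℝ (Fin (finrank ℝ E - finrank ℝ S))) ≃L[ℝ] E,
      ∀ v, Θ (v, 0) = D v := by
  obtain ⟨C, hC⟩ := Submodule.exists_isCompl (LinearMap.range (D : S →ₗ[ℝ] E))
  have hrank := Submodule.finrank_add_eq_of_isCompl hC
  rw [LinearMap.finrank_range_of_inj hD] at hrank
  have hk : finrank ℝ (EuclideanSpace ℝ (Fin (finrank ℝ E - finrank ℝ S))) = finrank ℝ C := by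
    rw [finrank_euclideanSpace_fin]; omega
  let κ := LinearEquiv.ofFinrankEq _ _ hk
  let Λ : S × EuclideanSpace ℝ (Fin (finrank ℝ E - finrank ℝ S)) →ₗ[ℝ] E :=
    (D : S →ₗ[ℝ] E).coprod (C.subtype ∘ₗ κ.toLinearMap)
  have hinj : Injective Λ := by
    rw [← LinearMap.ker_eq_bot, LinearMap.ker_eq_bot']
    rintro ⟨v, w⟩ hv
    have h1 : D v + (κ w : E) = 0 := hv
    have h2 : D v = 0 := by
      refine Submodule.disjoint_def.mp hC.disjoint _ ⟨v, rfl⟩ ?_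
      rw [eq_neg_of_add_eq_zero_left h1]
      exact C.neg_mem (κ w).2
    have h3 : v = 0 := hD (by rw [h2, map_zero])
    rw [h2, zero_add, Submodule.coe_eq_zero, LinearEquiv.map_eq_zero_iff] at h1
    rw [h3, h1]; rfl
  have hdim : finrank ℝ (S × EuclideanSpace ℝ (Fin (finrank ℝ E - finrank ℝ S))) =
      finrank ℝ E := by
    rw [finrank_prod, finrank_euclideanSpace_fin]; omega
  refine ⟨(LinearEquiv.ofInjectiveOfFinrankEq Λ hinj hdim).toContinuousLinearEquiv, fun v => ?_⟩
  change D v + (κ 0 : E) = D v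
  simp

end LinearNormalForm

section ChartCoordinates

variable {E S : Type*} [NormedAddCommGroup E] [NormedSpace ℝ E]
  [NormedAddCommGroup S] [NormedSpace ℝ S]
  {M N : Type*} [TopologicalSpace M] [ChartedSpace E M] [TopologicalSpace N] [ChartedSpace S N]
  {n : ℕ∞ω}

theorem trans_mem_maximalAtlas [IsManifold 𝓘(ℝ, E) n M] {c : OpenPartialHomeomorph M E}
    (hc : c ∈ IsManifold.maximalAtlas 𝓘(ℝ, E) n M) {e : OpenPartialHomeomorph E E}
    (he : e ∈ contDiffGroupoid n 𝓘(ℝ, E)) :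
    c.trans e ∈ IsManifold.maximalAtlas 𝓘(ℝ, E) n M := by
  rw [IsManifold.mem_maximalAtlas_iff, mem_maximalAtlas_iff]
  intro c' hc'
  have hc'' := IsManifold.subset_maximalAtlas (I := 𝓘(ℝ, E)) (n := n) hc'
  constructor
  · rw [OpenPartialHomeomorph.trans_symm_eq_symm_trans_symm, OpenPartialHomeomorph.trans_assoc]
    exact (contDiffGroupoid n 𝓘(ℝ, E)).trans ((contDiffGroupoid n 𝓘(ℝ, E)).symm he)
      (IsManifold.compatible_of_mem_maximalAtlas hc hc'')
  · rw [← OpenPartialHomeomorph.trans_assoc]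
    exact (contDiffGroupoid n 𝓘(ℝ, E)).trans
      (IsManifold.compatible_of_mem_maximalAtlas hc'' hc) he

theorem contDiffOn_chartAt_comp [IsManifold 𝓘(ℝ, E) n M] [IsManifold 𝓘(ℝ, S) n N]
    {f : M → N} (hf : ContMDiff 𝓘(ℝ, E) 𝓘(ℝ, S) n f) (x : M) (y : N) :
    ContDiffOn ℝ n (chartAt S y ∘ f ∘ (chartAt E x).symm)
      ((chartAt E x).target ∩ (chartAt E x).symm ⁻¹' (f ⁻¹' (chartAt S y).source)) := by
  have := (contMDiff_iff.mp hf).2 x y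
  simpa only [mfld_simps] using this

theorem isOpen_chartAt_comp_domain {E S M N : Type*} [TopologicalSpace E] [TopologicalSpace S]
    [TopologicalSpace M] [ChartedSpace E M] [TopologicalSpace N] [ChartedSpace S N]
    {f : M → N} (hf : Continuous f) (x : M) (y : N) :
    IsOpen ((chartAt E x).target ∩ (chartAt E x).symm ⁻¹' (f ⁻¹' (chartAt S y).source)) :=
  (chartAt E x).isOpen_inter_preimage_symm ((chartAt S y).open_source.preimage hf)

theorem hasFDerivAt_chartAt_comp {f : M → N} (hf : ContMDiff 𝓘(ℝ, E) 𝓘(ℝ, S) n f) (hn : n ≠ 0)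
    (x : M) :
    HasFDerivAt (chartAt S (f x) ∘ f ∘ (chartAt E x).symm)
      (mfderiv 𝓘(ℝ, E) 𝓘(ℝ, S) f x : E →L[ℝ] S) (chartAt E x x) := by
  have := ((hf x).mdifferentiableAt hn).hasMFDerivAt.2
  simp only [mfld_simps] at this
  exact this.hasFDerivAt_of_univ

end ChartCoordinates

section NormalForm

variable {E S : Type*} [NormedAddCommGroup E] [NormedSpace ℝ E] [FiniteDimensional ℝ E]
  [NormedAddCommGroup S] [NormedSpace ℝ S] [FiniteDimensional ℝ S]
  {M N : Type*} [TopologicalSpace M] [ChartedSpace E M] [TopologicalSpace N] [ChartedSpace S N]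
  {n : ℕ∞ω} [IsManifold 𝓘(ℝ, E) n M] [IsManifold 𝓘(ℝ, S) n N]

/-- In finite dimensions, a map with surjective derivative at a point is a submersion there. -/
theorem isSubmersionAtOfComplement_of_surjective {f : M → N}
    (hf : ContMDiff 𝓘(ℝ, E) 𝓘(ℝ, S) n f) (hn : n ≠ 0) {x : M}
    (hx : Surjective (mfderiv 𝓘(ℝ, E) 𝓘(ℝ, S) f x)) :
    Manifold.IsSubmersionAtOfComplement
      (EuclideanSpace ℝ (Fin (finrank ℝ E - finrank ℝ S))) 𝓘(ℝ, E) 𝓘(ℝ, S) n f x := by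
  set D : E →L[ℝ] S := mfderiv 𝓘(ℝ, E) 𝓘(ℝ, S) f x with hD
  obtain ⟨Θ, hΘ⟩ := exists_equiv_fst_of_surjective D hx
  have := FiniteDimensional.complete ℝ E
  set F : E → S := chartAt S (f x) ∘ f ∘ (chartAt E x).symm with hF
  -- Replacing the first component of the linear coordinates `Θ` by `f` gives new coordinates.
  set Φ : E → E := fun y => Θ.symm (F y, (Θ y).2) with hΦ
  have hderiv : HasFDerivAt Φ ((ContinuousLinearEquiv.refl ℝ E : E ≃L[ℝ] E) : E →L[ℝ] E)
      (chartAt E x x) := by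
    have h := Θ.symm.hasFDerivAt.comp (chartAt E x x)
      ((hasFDerivAt_chartAt_comp hf hn x).prodMk
        ((ContinuousLinearMap.snd ℝ S _).hasFDerivAt.comp (chartAt E x x) Θ.hasFDerivAt))
    refine h.congr_fderiv ?_
    ext v
    change Θ.symm (D v, (Θ v).2) = v
    rw [← hΘ v]; exact Θ.symm_apply_apply v
  have hdiff : ContDiffOn ℝ n Φ _ :=
    Θ.symm.contDiff.comp_contDiffOn
      ((contDiffOn_chartAt_comp hf x (f x)).prodMk (contDiff_snd.comp Θ.contDiff).contDiffOn)
  obtain ⟨e, he, hxe, -, heΦ⟩ := exists_mem_contDiffGroupoid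
    (isOpen_chartAt_comp_domain hf.continuous x (f x)) ⟨mem_chart_target E x, by simp⟩ hn hdiff
    hderiv
  refine Manifold.IsSubmersionAtOfComplement.mk_of_continuousAt hf.continuous.continuousAt Θ
    ((chartAt E x).trans e) (chartAt S (f x)) (by simpa using hxe) (mem_chart_source S (f x))
    ?_ (IsManifold.chart_mem_maximalAtlas (f x)) ?_
  · exact trans_mem_maximalAtlas (IsManifold.chart_mem_maximalAtlas x) he
  · intro z hz
    have hz' : e.symm z ∈ (chartAt E x).target ∧ z ∈ e.target := by
      simpa [and_comm] using hz
    have hze : Φ (e.symm z) = z := by rw [← heΦ]; exact e.right_inv hz'.2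
    change F (e.symm z) = (Θ z).1
    conv_rhs => rw [← hze]
    simp [hΦ]

/-- In finite dimensions, a map with injective derivative at a point is an immersion there. -/
theorem isImmersionAtOfComplement_of_injective {f : N → M}
    (hf : ContMDiff 𝓘(ℝ, S) 𝓘(ℝ, E) n f) (hn : n ≠ 0) {x : N}
    (hx : Injective (mfderiv 𝓘(ℝ, S) 𝓘(ℝ, E) f x)) :
    Manifold.IsImmersionAtOfComplement
      (EuclideanSpace ℝ (Fin (finrank ℝ E - finrank ℝ S))) 𝓘(ℝ, S) 𝓘(ℝ, E) n f x := by
  set D : S →L[ℝ] E := mfderiv 𝓘(ℝ, S) 𝓘(ℝ, E) f x with hD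
  obtain ⟨Θ, hΘ⟩ := exists_equiv_inl_of_injective D hx
  have := FiniteDimensional.complete ℝ E
  set F : S → E := chartAt E (f x) ∘ f ∘ (chartAt S x).symm with hF
  set s₀ : S := chartAt S x x with hs₀
  set U := (chartAt S x).target ∩ (chartAt S x).symm ⁻¹' (f ⁻¹' (chartAt E (f x)).source) with hU
  have hUo : IsOpen U := isOpen_chartAt_comp_domain hf.continuous x (f x)
  -- Thickening `f` linearly in the directions complementary to `D` gives a local diffeomorphism.
  set Φ : E → E := fun z => F (Θ.symm z).1 + Θ (0, (Θ.symm z).2) with hΦ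
  have hderiv : HasFDerivAt Φ ((ContinuousLinearEquiv.refl ℝ E : E ≃L[ℝ] E) : E →L[ℝ] E)
      (Θ (s₀, 0)) := by
    have h1 : HasFDerivAt (fun z => (Θ.symm z).1) ((ContinuousLinearMap.fst ℝ S _).comp
        Θ.symm.toContinuousLinearMap) (Θ (s₀, 0)) :=
      ((ContinuousLinearMap.fst ℝ S _).comp Θ.symm.toContinuousLinearMap).hasFDerivAt
    have h2 := (Θ.toContinuousLinearMap.comp ((ContinuousLinearMap.inr ℝ S _).comp
      ((ContinuousLinearMap.snd ℝ S _).comp Θ.symm.toContinuousLinearMap))).hasFDerivAt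
        (x := Θ (s₀, 0))
    have h3 : HasFDerivAt F D (Θ.symm (Θ (s₀, 0))).1 := by
      rw [Θ.symm_apply_apply]; exact hasFDerivAt_chartAt_comp hf hn x
    refine ((h3.comp (Θ (s₀, 0)) h1).add h2).congr_fderiv ?_
    ext v
    change D (Θ.symm v).1 + Θ (0, (Θ.symm v).2) = v
    rw [← hΘ, ← map_add, Prod.mk_add_mk, add_zero, zero_add]
    exact Θ.apply_symm_apply v
  have hdiff : ContDiffOn ℝ n Φ ((fun z => (Θ.symm z).1) ⁻¹' U) := by
    refine ContDiffOn.add ?_ ?_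
    · exact (contDiffOn_chartAt_comp hf x (f x)).comp
        (contDiff_fst.comp Θ.symm.contDiff).contDiffOn fun z hz => hz
    · exact (Θ.toContinuousLinearMap.comp ((ContinuousLinearMap.inr ℝ S _).comp
        ((ContinuousLinearMap.snd ℝ S _).comp Θ.symm.toContinuousLinearMap))).contDiff.contDiffOn
  obtain ⟨e, he, hxe, -, heΦ⟩ := exists_mem_contDiffGroupoid
    (hUo.preimage (continuous_fst.comp Θ.symm.continuous))
    (by simp [hU, hs₀]) hn hdiff hderiv
  have hΦ₀ : ∀ s, Φ (Θ (s, 0)) = F s := by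
    intro s
    have : Θ ((0 : S), (0 : EuclideanSpace ℝ (Fin (finrank ℝ E - finrank ℝ S)))) = 0 :=
      map_zero Θ
    simp [hΦ, this]
  have hV : IsOpen ((fun s : S => Θ (s, 0)) ⁻¹' e.source) :=
    e.open_source.preimage (Θ.continuous.comp (by fun_prop))
  refine Manifold.IsImmersionAtOfComplement.mk_of_continuousAt hf.continuous.continuousAt Θ
    ((chartAt S x).trans (OpenPartialHomeomorph.ofSet _ hV)) ((chartAt E (f x)).trans e.symm)
    ?_ ?_ (trans_mem_maximalAtlas (IsManifold.chart_mem_maximalAtlas x)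
      (ofSet_mem_contDiffGroupoid hV))
    (trans_mem_maximalAtlas (IsManifold.chart_mem_maximalAtlas (f x))
      ((contDiffGroupoid n 𝓘(ℝ, E)).symm he)) ?_
  · simpa using hxe
  · have h1 : e (Θ (s₀, 0)) = chartAt E (f x) (f x) := by
      rw [heΦ, hΦ₀]; simp [hF, hs₀]
    have h2 := e.map_source hxe
    rw [h1] at h2
    simpa using h2
  · intro s hs
    have hs' : s ∈ (chartAt S x).target ∧ Θ (s, 0) ∈ e.source := by
      simpa [and_comm] using hs
    change e.symm (F s) = Θ (s, 0)
    rw [← hΦ₀, ← heΦ, e.left_inv hs'.2]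

end NormalForm

/-! ### Homogeneous spaces from local slices -/

section Slice

variable {E : Type*} [NormedAddCommGroup E] [NormedSpace ℝ E] {HE : Type*} [TopologicalSpace HE]
  {I : ModelWithCorners ℝ E HE} {n : ℕ∞ω}
  {G : Type*} [Group G] [TopologicalSpace G] [ChartedSpace HE G] {K : Subgroup G}
  {S : Type*} [NormedAddCommGroup S] [NormedSpace ℝ S]

variable (I n K S) in
/-- A local slice for the right action of a subgroup `K` on a Lie group `G`: a neighbourhood
`nhd` of `1` on which the cosets of `K` are parametrised by an open subset of a normed space `S`,
through a smooth map `coord` that is constant on cosets within `nhd`, and a smooth map `lift`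
that sends the coordinate of an element of `nhd` to a representative of its coset. -/
structure Slice where
  /-- The neighbourhood of `1`; it need not be a union of cosets. -/
  nhd : Set G
  /-- The coordinate of the coset of an element of `nhd`. -/
  coord : G → S
  /-- A representative of the coset with the given coordinate. -/
  lift : S → G
  isOpen_nhd : IsOpen nhd
  one_mem : 1 ∈ nhd
  isOpen_image : IsOpen (coord '' nhd)
  contMDiffOn_coord : ContMDiffOn I 𝓘(ℝ, S) n coord nhd
  contMDiffOn_lift : ContMDiffOn 𝓘(ℝ, S) I n lift (coord '' nhd)
  coord_eq : ∀ g ∈ nhd, ∀ g' ∈ nhd, (g : G ⧸ K) = g' → coord g = coord g'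
  mk_lift : ∀ g ∈ nhd, (lift (coord g) : G ⧸ K) = g

namespace Slice

variable (s : Slice I n K S)

/-- The coordinate of a coset that meets the neighbourhood of the slice. -/
def cosetCoord (x : G ⧸ K) : S := s.coord (invFunOn ((↑) : G → G ⧸ K) s.nhd x)

theorem cosetCoord_mk {g : G} (hg : g ∈ s.nhd) : s.cosetCoord (g : G ⧸ K) = s.coord g := by
  have h : ∃ a ∈ s.nhd, (a : G ⧸ K) = g := ⟨g, hg, rfl⟩
  exact s.coord_eq _ (invFunOn_mem h) _ hg (invFunOn_eq h)

variable [IsTopologicalGroup G] [LieGroup I n G]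

/-- On the union of the cosets that meet `nhd`, the coordinate of the coset depends smoothly on
the element: near each point, it is `coord` precomposed with a right translation by `K`. -/
theorem contMDiffAt_cosetCoord_mk {g : G} (hg : (g : G ⧸ K) ∈ ((↑) : G → G ⧸ K) '' s.nhd) :
    ContMDiffAt I 𝓘(ℝ, S) n (fun g : G => s.cosetCoord (g : G ⧸ K)) g := by
  obtain ⟨v, hv, hvg⟩ := hg
  obtain ⟨k, hk, rfl⟩ : ∃ k ∈ K, g * k = v :=
    ⟨g⁻¹ * v, QuotientGroup.eq.mp hvg.symm, mul_inv_cancel_left g v⟩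
  have h1 : ContMDiffAt I 𝓘(ℝ, S) n (fun g : G => s.coord (g * k)) g :=
    ContMDiffAt.comp g (s.contMDiffOn_coord.contMDiffAt (s.isOpen_nhd.mem_nhds hv))
      (contMDiff_mul_right (I := I) (n := n) (a := k)).contMDiffAt
  refine h1.congr_of_eventuallyEq ?_
  have h2 : ∀ᶠ g' in 𝓝 g, g' * k ∈ s.nhd :=
    (continuous_mul_const k).continuousAt.eventually (s.isOpen_nhd.mem_nhds hv)
  filter_upwards [h2] with g' hg'
  rw [← QuotientGroup.mk_mul_of_mem g' hk, s.cosetCoord_mk hg']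

/-- The chart of `G ⧸ K` around the base point that is given by the slice. -/
def baseChart : OpenPartialHomeomorph (G ⧸ K) S where
  toFun := s.cosetCoord
  invFun y := (s.lift y : G ⧸ K)
  source := (↑) '' s.nhd
  target := s.coord '' s.nhd
  map_source' := by
    rintro _ ⟨g, hg, rfl⟩
    exact ⟨g, hg, (s.cosetCoord_mk hg).symm⟩
  map_target' := by
    rintro _ ⟨g, hg, rfl⟩
    exact ⟨g, hg, (s.mk_lift g hg).symm⟩
  left_inv' := by
    rintro _ ⟨g, hg, rfl⟩
    rw [s.cosetCoord_mk hg, s.mk_lift g hg]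
  right_inv' := by
    rintro _ ⟨g, hg, rfl⟩
    rw [s.mk_lift g hg, s.cosetCoord_mk hg]
  open_source := QuotientGroup.isOpenMap_coe _ s.isOpen_nhd
  open_target := s.isOpen_image
  continuousOn_toFun := by
    rintro _ ⟨g, hg, rfl⟩
    refine ContinuousAt.continuousWithinAt ?_
    rw [ContinuousAt, ← QuotientGroup.isOpenQuotientMap_mk.map_nhds_eq, tendsto_map'_iff]
    exact (s.contMDiffAt_cosetCoord_mk ⟨g, hg, rfl⟩).continuousAt
  continuousOn_invFun :=
    QuotientGroup.continuous_mk.comp_continuousOn s.contMDiffOn_lift.continuousOn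

/-- The translate of the base chart by an element of `G`. -/
def chart (g : G) : OpenPartialHomeomorph (G ⧸ K) S :=
  (Homeomorph.smul g⁻¹).toOpenPartialHomeomorph.trans s.baseChart

theorem chart_apply (g : G) (x : G ⧸ K) : s.chart g x = s.cosetCoord (g⁻¹ • x) := rfl

theorem chart_symm_apply (g : G) (y : S) : (s.chart g).symm y = ((g * s.lift y : G) : G ⧸ K) := by
  change (g⁻¹)⁻¹ • (s.lift y : G ⧸ K) = _
  rw [inv_inv]; rfl

theorem mem_chart_source {g : G} {x : G ⧸ K} :
    x ∈ (s.chart g).source ↔ g⁻¹ • x ∈ ((↑) : G → G ⧸ K) '' s.nhd := by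
  simp [chart, baseChart]

theorem chart_target (g : G) : (s.chart g).target = s.coord '' s.nhd := by
  simp [chart, baseChart]

theorem mk_mem_chart_source (g : G) : (g : G ⧸ K) ∈ (s.chart g).source := by
  rw [mem_chart_source]
  exact ⟨1, s.one_mem, by rw [MulAction.Quotient.smul_coe, smul_eq_mul, inv_mul_cancel]⟩

/-- The homogeneous space `G ⧸ K` is covered by the translates of the chart given by a slice. -/
abbrev chartedSpace : ChartedSpace S (G ⧸ K) where
  atlas := range s.chart
  chartAt x := s.chart x.out
  mem_chart_source x := by
    simpa using s.mk_mem_chart_source x.out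
  chart_mem_atlas x := ⟨x.out, rfl⟩

theorem contMDiffAt_chart_comp_mk {g g' : G} (h : (g' : G ⧸ K) ∈ (s.chart g).source) :
    ContMDiffAt I 𝓘(ℝ, S) n (fun a : G => s.chart g (a : G ⧸ K)) g' := by
  rw [mem_chart_source] at h
  exact ContMDiffAt.comp (g := fun a : G => s.cosetCoord (a : G ⧸ K)) g'
    (s.contMDiffAt_cosetCoord_mk h)
    (contMDiff_mul_left (I := I) (n := n) (a := g⁻¹)).contMDiffAt

theorem isManifold : letI := s.chartedSpace; IsManifold 𝓘(ℝ, S) n (G ⧸ K) := by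
  let := s.chartedSpace
  refine isManifold_of_contDiffOn 𝓘(ℝ, S) n (G ⧸ K) ?_
  rintro _ _ ⟨g, rfl⟩ ⟨g', rfl⟩
  simp only [modelWithCornersSelf_coe, modelWithCornersSelf_coe_symm, Function.comp_id,
    Function.id_comp, preimage_id, range_id, inter_univ]
  rw [← contMDiffOn_iff_contDiffOn]
  intro y hy
  have hy1 : y ∈ s.coord '' s.nhd := by rw [← s.chart_target g]; exact hy.1
  have hy2 : ((g * s.lift y : G) : G ⧸ K) ∈ (s.chart g').source := by
    rw [← chart_symm_apply]; exact hy.2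
  refine ContMDiffAt.contMDiffWithinAt ?_
  have h1 : ContMDiffAt 𝓘(ℝ, S) I n (fun y => g * s.lift y) y :=
    ContMDiffAt.comp y (contMDiff_mul_left (I := I) (n := n) (a := g)).contMDiffAt
      (s.contMDiffOn_lift.contMDiffAt (s.isOpen_image.mem_nhds hy1))
  have h2 := ContMDiffAt.comp (g := fun a : G => s.chart g' (a : G ⧸ K)) y
    (s.contMDiffAt_chart_comp_mk hy2) h1
  refine h2.congr_of_eventuallyEq (Eventually.of_forall fun z => ?_)
  change s.chart g' ((s.chart g).symm z) = _
  rw [chart_symm_apply]; rfl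

theorem contMDiff_mk : letI := s.chartedSpace;
    ContMDiff I 𝓘(ℝ, S) n ((↑) : G → G ⧸ K) := by
  let := s.chartedSpace
  have := s.isManifold
  intro g
  have hg := s.mk_mem_chart_source g
  have hmem : s.chart g ∈ IsManifold.maximalAtlas 𝓘(ℝ, S) n (G ⧸ K) :=
    IsManifold.subset_maximalAtlas ⟨g, rfl⟩
  have h := ContMDiffAt.comp g
    (contMDiffAt_symm_of_mem_maximalAtlas hmem ((s.chart g).map_source hg))
    (s.contMDiffAt_chart_comp_mk hg)
  refine h.congr_of_eventuallyEq ?_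
  filter_upwards [QuotientGroup.continuous_mk.continuousAt.eventually
    ((s.chart g).open_source.mem_nhds hg)] with a ha
  exact ((s.chart g).left_inv ha).symm

theorem exists_section (g : G) : letI := s.chartedSpace;
    ∃ σ : G ⧸ K → G, ContMDiffAt 𝓘(ℝ, S) I n σ (g : G ⧸ K) ∧ σ g = g ∧
      ∀ᶠ x in 𝓝 (g : G ⧸ K), (σ x : G ⧸ K) = x := by
  let := s.chartedSpace
  have := s.isManifold
  have hg := s.mk_mem_chart_source g
  have hmem : s.chart g ∈ IsManifold.maximalAtlas 𝓘(ℝ, S) n (G ⧸ K) :=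
    IsManifold.subset_maximalAtlas ⟨g, rfl⟩
  have hchart : s.chart g (g : G ⧸ K) = s.coord 1 := by
    rw [chart_apply, MulAction.Quotient.smul_coe, smul_eq_mul, inv_mul_cancel,
      s.cosetCoord_mk s.one_mem]
  -- `lift` need not send the base point to `1`, only to an element of `K`.
  set k := s.lift (s.coord 1) with hk
  have hkK : k⁻¹ ∈ K := by
    have := QuotientGroup.eq.mp (s.mk_lift 1 s.one_mem)
    rwa [mul_one] at this
  refine ⟨fun x => g * s.lift (s.chart g x) * k⁻¹, ?_, ?_, ?_⟩
  · have h1 : ContMDiffAt 𝓘(ℝ, S) I n s.lift (s.chart g (g : G ⧸ K)) :=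
      s.contMDiffOn_lift.contMDiffAt (s.isOpen_image.mem_nhds
        (by rw [hchart]; exact ⟨1, s.one_mem, rfl⟩))
    have h2 := ContMDiffAt.comp (g : G ⧸ K) h1 (contMDiffAt_of_mem_maximalAtlas hmem hg)
    exact (contMDiff_mul_right (I := I) (n := n) (a := k⁻¹)).contMDiffAt.comp _
      ((contMDiff_mul_left (I := I) (n := n) (a := g)).contMDiffAt.comp _ h2)
  · simp only [hchart, ← hk, mul_inv_cancel_right]
  · filter_upwards [(s.chart g).open_source.mem_nhds hg] with x hx
    rw [QuotientGroup.mk_mul_of_mem _ hkK, ← chart_symm_apply, (s.chart g).left_inv hx]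

end Slice

end Slice

section Quotient

variable {E : Type*} [NormedAddCommGroup E] [NormedSpace ℝ E] {HE : Type*} [TopologicalSpace HE]
  {I : ModelWithCorners ℝ E HE} {n : ℕ∞ω}
  {G : Type*} [Group G] [TopologicalSpace G] [ChartedSpace HE G] {K : Subgroup G}
  {S : Type*} [NormedAddCommGroup S] [NormedSpace ℝ S]
  [ChartedSpace S (G ⧸ K)]

variable (I n K S) in
/-- The projection `G → G ⧸ K` is smooth and has smooth local sections through every point. -/
structure HasSmoothSections : Prop where
  contMDiff_mk : ContMDiff I 𝓘(ℝ, S) n ((↑) : G → G ⧸ K)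
  exists_section (g : G) : ∃ σ : G ⧸ K → G, ContMDiffAt 𝓘(ℝ, S) I n σ (g : G ⧸ K) ∧ σ g = g ∧
    ∀ᶠ x in 𝓝 (g : G ⧸ K), (σ x : G ⧸ K) = x

namespace HasSmoothSections

theorem contMDiff_iff_comp_mk (h : HasSmoothSections I n K S)
    {E' : Type*} [NormedAddCommGroup E'] [NormedSpace ℝ E']
    {H' : Type*} [TopologicalSpace H'] {I' : ModelWithCorners ℝ E' H'}
    {N : Type*} [TopologicalSpace N] [ChartedSpace H' N] {f : G ⧸ K → N} :
    ContMDiff 𝓘(ℝ, S) I' n f ↔ ContMDiff I I' n (fun g : G => f g) := by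
  refine ⟨fun hf => hf.comp h.contMDiff_mk, fun hf => ?_⟩
  refine QuotientGroup.mk_surjective.forall.mpr fun g => ?_
  obtain ⟨σ, hσ, -, hσx⟩ := h.exists_section g
  refine (ContMDiffAt.comp (g : G ⧸ K) (hf (σ g)) hσ).congr_of_eventuallyEq ?_
  filter_upwards [hσx] with x hx
  simp only [Function.comp_apply, hx]

theorem contMDiffSMul [LieGroup I n G] (h : HasSmoothSections I n K S) :
    ContMDiffSMul I 𝓘(ℝ, S) n G (G ⧸ K) where
  contMDiff_smul := by
    rintro ⟨g, x⟩
    obtain ⟨a, rfl⟩ := QuotientGroup.mk_surjective x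
    obtain ⟨σ, hσ, -, hσx⟩ := h.exists_section a
    have h1 : ContMDiffAt (I.prod 𝓘(ℝ, S)) I n (fun p : G × (G ⧸ K) => p.1 * σ p.2)
        (g, (a : G ⧸ K)) :=
      contMDiffAt_fst.mul (ContMDiffAt.comp (g, (a : G ⧸ K)) hσ contMDiffAt_snd)
    refine (ContMDiffAt.comp (g, (a : G ⧸ K)) (h.contMDiff_mk (g * σ a))
      h1).congr_of_eventuallyEq ?_
    filter_upwards [(continuous_snd (X := G)).continuousAt.eventually hσx] with p hp
    have hp' : (σ p.2 : G ⧸ K) = p.2 := hp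
    conv_lhs => rw [← hp']
    rfl

theorem mfderiv_mk_surjective (h : HasSmoothSections I n K S) (hn : n ≠ 0) (g : G) :
    Surjective (mfderiv I 𝓘(ℝ, S) ((↑) : G → G ⧸ K) g) := by
  obtain ⟨σ, hσ, hσg, hσx⟩ := h.exists_section g
  have hid : HasMFDerivAt 𝓘(ℝ, S) 𝓘(ℝ, S) (((↑) : G → G ⧸ K) ∘ σ) (g : G ⧸ K)
      (ContinuousLinearMap.id ℝ (TangentSpace 𝓘(ℝ, S) (g : G ⧸ K))) :=
    (hasMFDerivAt_id (g : G ⧸ K)).congr_of_eventuallyEq hσx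
  have hπ : MDifferentiableAt I 𝓘(ℝ, S) ((↑) : G → G ⧸ K) (σ g) :=
    (h.contMDiff_mk _).mdifferentiableAt hn
  have hc := hπ.hasMFDerivAt.comp (g : G ⧸ K) (hσ.mdifferentiableAt hn).hasMFDerivAt
  have he := hasMFDerivAt_unique hc hid
  intro v
  have hv := DFunLike.congr_fun he v
  rw [hσg] at hv
  exact ⟨_, hv⟩

end HasSmoothSections

/-- If `φ ∘ j` has injective derivative, where `j` maps a vector space to a manifold of the same
finite dimension, then so has `φ`. -/
theorem mfderiv_injective_of_comp [FiniteDimensional ℝ S] {M N : Type*} [TopologicalSpace M]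
    [ChartedSpace S M] [TopologicalSpace N] [ChartedSpace E N] {φ : M → N} {j : S → M} {y : S}
    (hj : MDifferentiableAt 𝓘(ℝ, S) 𝓘(ℝ, S) j y)
    (hφ : MDifferentiableAt 𝓘(ℝ, S) 𝓘(ℝ, E) φ (j y))
    (hinj : Injective (mfderiv 𝓘(ℝ, S) 𝓘(ℝ, E) (φ ∘ j) y)) :
    Injective (mfderiv 𝓘(ℝ, S) 𝓘(ℝ, E) φ (j y)) := by
  rw [mfderiv_comp y hφ hj] at hinj
  set A : S →L[ℝ] E := mfderiv 𝓘(ℝ, S) 𝓘(ℝ, E) φ (j y)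
  set B : S →L[ℝ] S := mfderiv 𝓘(ℝ, S) 𝓘(ℝ, S) j y
  have hAB : Injective (A ∘ B) := hinj
  have hB : Surjective B :=
    (LinearMap.injective_iff_surjective (f := (B : S →ₗ[ℝ] S))).mp hAB.of_comp
  change Injective A
  intro u v huv
  obtain ⟨u, rfl⟩ := hB u
  obtain ⟨v, rfl⟩ := hB v
  exact congrArg B (hAB huv)

end Quotient

/-! ### Orbit maps as embeddings -/

section Embedding

variable {G X : Type*} [Group G] [TopologicalSpace G] [IsTopologicalGroup G] [TopologicalSpace X]
  [MulAction G X] [ContinuousConstSMul G X]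

/-- By homogeneity, the orbit map of `x` is an embedding of `G ⧸ stabilizer G x` as soon as, at the
base point, `g • x → x` forces the coset of `g` to tend to the trivial coset. -/
theorem isEmbedding_ofQuotientStabilizer {x : X} (hc : Continuous fun g : G => g • x)
    (hx : Tendsto ((↑) : G → G ⧸ MulAction.stabilizer G x) (comap (fun g : G => g • x) (𝓝 x))
      (𝓝 ((1 : G) : G ⧸ MulAction.stabilizer G x))) :
    IsEmbedding (MulAction.ofQuotientStabilizer G x) := by
  set φ := MulAction.ofQuotientStabilizer G x with hφ
  have hφmk : ∀ g : G, φ (g : G ⧸ MulAction.stabilizer G x) = g • x := fun g => rfl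
  have hφc : Continuous φ := QuotientGroup.isOpenQuotientMap_mk.isQuotientMap.continuous_iff.mpr hc
  have hbase : comap φ (𝓝 x) ≤ 𝓝 ((1 : G) : G ⧸ MulAction.stabilizer G x) := by
    have h1 : comap (fun g : G => g • x) (𝓝 x) =
        comap ((↑) : G → G ⧸ MulAction.stabilizer G x) (comap φ (𝓝 x)) := by
      rw [comap_comap]; rfl
    rwa [h1, Tendsto, map_comap_of_surjective QuotientGroup.mk_surjective] at hx
  refine ⟨isInducing_iff_nhds.mpr fun y => le_antisymm hφc.continuousAt.le_comap ?_,
    MulAction.injective_ofQuotientStabilizer G x⟩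
  obtain ⟨g, rfl⟩ := QuotientGroup.mk_surjective y
  have h2 : Tendsto (fun z : G ⧸ MulAction.stabilizer G x => g⁻¹ • z) (comap φ (𝓝 (φ g)))
      (comap φ (𝓝 x)) := by
    rw [tendsto_comap_iff]
    have h3 : φ ∘ (fun z : G ⧸ MulAction.stabilizer G x => g⁻¹ • z) = (g⁻¹ • ·) ∘ φ :=
      funext fun z => MulAction.ofQuotientStabilizer_smul G x g⁻¹ z
    rw [h3]
    have h4 : Tendsto (fun z : X => g⁻¹ • z) (𝓝 (φ g)) (𝓝 x) := by
      have := (continuous_const_smul (T := X) g⁻¹).tendsto (φ g)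
      rwa [hφmk, inv_smul_smul] at this
    exact h4.comp tendsto_comap
  have h5 := ((continuous_const_smul (T := G ⧸ MulAction.stabilizer G x) g).tendsto
    ((1 : G) : G ⧸ MulAction.stabilizer G x)).comp (h2.mono_right hbase)
  rw [MulAction.Quotient.smul_coe, smul_eq_mul, mul_one] at h5
  have h6 : (fun z => g • z) ∘ (fun z : G ⧸ MulAction.stabilizer G x => g⁻¹ • z) = id :=
    funext fun z => smul_inv_smul g z
  rw [h6] at h5
  exact h5

end Embedding

/-! ### The action on tensors and the base tensor -/

section Action

variable {d : ℕ} {n : Fin d → ℕ} {r : ℕ}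

theorem smul_tensor_add (g : G n) (S T : Tensor n) : g • (S + T) = g • S + g • T := by
  funext k
  simp only [smul_apply, Pi.add_apply, mul_add, Finset.sum_add_distrib]

theorem smul_tensor_smul (g : G n) (c : ℝ) (T : Tensor n) : g • (c • T) = c • g • T := by
  funext k
  simp only [smul_apply, Pi.smul_apply, smul_eq_mul, Finset.mul_sum]
  exact Finset.sum_congr rfl fun l _ => by ring

/-- The action of an element of `G` on tensors, as a linear map. -/
def actionLin (g : G n) : Tensor n →ₗ[ℝ] Tensor n where
  toFun T := g • T
  map_add' := smul_tensor_add g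
  map_smul' := smul_tensor_smul g

/-- The action of an element of `G` on tensors, as a continuous linear equivalence. -/
def actionEquiv (g : G n) : Tensor n ≃L[ℝ] Tensor n :=
  (LinearEquiv.ofLinearMap (actionLin g) (actionLin g⁻¹)
    (LinearMap.ext fun T => smul_inv_smul g T)
    (LinearMap.ext fun T => inv_smul_smul g T)).toContinuousLinearEquiv

theorem actionEquiv_apply (g : G n) (T : Tensor n) : actionEquiv g T = g • T := rfl

instance : ContinuousConstSMul (G n) (Tensor n) :=
  ⟨fun g => (actionEquiv g).continuous⟩

variable (n) in
/-- The `j`-th standard basis vectors `e_i^j` of all factors `ℝ^(n i)`. -/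
def stdVec (j : Fin r) : ∀ i, Fin (n i) → ℝ :=
  fun _ a => if (a : ℕ) = (j : ℕ) then 1 else 0

/-- The position `(j, …, j)` of a tensor. -/
def diagIdx (hr : ∀ i, r ≤ n i) (j : Fin r) : ∀ i, Fin (n i) := fun i => Fin.castLE (hr i) j

theorem diagIdx_apply (hr : ∀ i, r ≤ n i) (j : Fin r) (i : Fin d) :
    diagIdx hr j i = Fin.castLE (hr i) j := rfl

theorem diagIdx_inj (hr : ∀ i, r ≤ n i) {j j' : Fin r} {i : Fin d} :
    diagIdx hr j i = diagIdx hr j' i ↔ j = j' := by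
  simp [diagIdx]

theorem stdVec_apply (hr : ∀ i, r ≤ n i) (j : Fin r) (i : Fin d) (a : Fin (n i)) :
    stdVec n j i a = if a = diagIdx hr j i then 1 else 0 := by
  simp [stdVec, diagIdx, Fin.ext_iff]

theorem stdVec_eq_single (hr : ∀ i, r ≤ n i) (j : Fin r) (i : Fin d) :
    stdVec n j i = Pi.single (diagIdx hr j i) 1 := by
  funext a
  rw [stdVec_apply hr, Pi.single_apply]

theorem baseTensor_eq : baseTensor n r = ∑ j : Fin r, outer (stdVec n j) := rfl

theorem prod_ite_eq (k l : ∀ i, Fin (n i)) :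
    ∏ i, (if k i = l i then (1 : ℝ) else 0) = if k = l then 1 else 0 := by
  split_ifs with h
  · simp [h]
  · obtain ⟨i, hi⟩ := Function.ne_iff.mp h
    exact Finset.prod_eq_zero (Finset.mem_univ i) (if_neg hi)

theorem outer_stdVec_apply (hr : ∀ i, r ≤ n i) (j : Fin r) (k : ∀ i, Fin (n i)) :
    outer (stdVec n j) k = if k = diagIdx hr j then 1 else 0 := by
  simp only [outer, stdVec_apply hr]
  exact prod_ite_eq k _

/-- The tuple of the `j`-th columns of the components of `X`. -/
def cols (hr : ∀ i, r ≤ n i) (X : ∀ i, Matrix (Fin (n i)) (Fin (n i)) ℝ) (j : Fin r) :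
    ∀ i, Fin (n i) → ℝ :=
  fun i a => X i a (diagIdx hr j i)

theorem mulVec_stdVec (hr : ∀ i, r ≤ n i) (X : ∀ i, Matrix (Fin (n i)) (Fin (n i)) ℝ)
    (j : Fin r) : (fun i => (X i).mulVec (stdVec n j i)) = cols hr X j := by
  funext i a
  rw [stdVec_eq_single hr, Matrix.mulVec_single_one]
  rfl

theorem smul_sum_tensor {ι : Type*} (s : Finset ι) (g : G n) (T : ι → Tensor n) :
    g • ∑ j ∈ s, T j = ∑ j ∈ s, g • T j :=
  map_sum (actionLin g) T s

theorem smul_baseTensor (hr : ∀ i, r ≤ n i) (g : G n) :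
    g • baseTensor n r = ∑ j, outer (cols hr (comp g) j) := by
  rw [baseTensor_eq, smul_sum_tensor]
  simp only [smul_outer, mulVec_stdVec hr]

end Action

/-! ### Matrices of given rank -/

section LinearAlgebra

/-- A linearly independent family of vectors can be prescribed as the first columns of an
invertible matrix. -/
theorem exists_isUnit_col_eq {m r : ℕ} (hr : r ≤ m) {v : Fin r → Fin m → ℝ}
    (hv : LinearIndependent ℝ v) :
    ∃ A : Matrix (Fin m) (Fin m) ℝ, IsUnit A ∧ ∀ j a, A a (Fin.castLE hr j) = v j a := by
  let b := Basis.sumExtend hv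
  have hb : ∀ j, b (Sum.inl j) = v j := fun j => by
    simp only [b, Basis.sumExtend, Basis.reindex_apply, Basis.coe_extend]
    rfl
  have h0 : Finite (Fin r ⊕ Basis.sumExtendIndex hv) := Module.Finite.finite_basis b
  have h1 : Finite (Basis.sumExtendIndex hv) :=
    Finite.of_injective Sum.inr (Sum.inr_injective (α := Fin r))
  have h2 : Fintype (Basis.sumExtendIndex hv) := Fintype.ofFinite _
  have hcard : Fintype.card (Basis.sumExtendIndex hv) = m - r := by
    have h3 := finrank_eq_card_basis b
    rw [finrank_fin_fun, Fintype.card_sum, Fintype.card_fin] at h3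
    omega
  let e : Fin m ≃ Fin r ⊕ Basis.sumExtendIndex hv :=
    ((finCongr (Nat.add_sub_of_le hr)).symm.trans finSumFinEquiv.symm).trans
      ((Equiv.refl _).sumCongr (Fintype.equivFinOfCardEq hcard).symm)
  have he : ∀ j, e (Fin.castLE hr j) = Sum.inl j := fun j => by
    have : Fin.cast (Nat.add_sub_of_le hr).symm (Fin.castLE hr j) = Fin.castAdd (m - r) j := by
      ext; simp
    simp [e, this]
  refine ⟨Matrix.of fun a k => b (e k) a, ?_, fun j a => ?_⟩
  · rw [← Matrix.linearIndependent_cols_iff_isUnit]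
    exact b.linearIndependent.comp e e.injective
  · rw [Matrix.of_apply, he, hb]

theorem linearIndependent_row_of_rank_eq {m : Type*} [Fintype m] {r : ℕ} {A : Matrix (Fin r) m ℝ}
    (hA : A.rank = r) : LinearIndependent ℝ A.row := by
  rw [linearIndependent_iff_card_eq_finrank_span, Set.finrank, ← Matrix.rank_eq_finrank_span_row,
    hA, Fintype.card_fin]

/-- A matrix of rank `r` can be reduced to the `r × r` identity. -/
theorem exists_mul_mul_eq_one {m k : Type*} [Fintype m] [DecidableEq m] [Fintype k]
    [DecidableEq k] (F : Matrix m k ℝ) :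
    ∃ (X : Matrix (Fin F.rank) m ℝ) (Y : Matrix k (Fin F.rank) ℝ), X * F * Y = 1 := by
  let f := F.mulVecLin
  obtain ⟨p, hp⟩ := (LinearMap.range f).subtype.exists_leftInverse_of_injective
    (Submodule.ker_subtype _)
  obtain ⟨s, hs⟩ := f.rangeRestrict.exists_rightInverse_of_surjective f.range_rangeRestrict
  let φ : LinearMap.range f ≃ₗ[ℝ] (Fin F.rank → ℝ) :=
    LinearEquiv.ofFinrankEq _ _ (by rw [finrank_fin_fun]; rfl)
  refine ⟨LinearMap.toMatrix' (φ.toLinearMap ∘ₗ p),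
    LinearMap.toMatrix' (s ∘ₗ φ.symm.toLinearMap), ?_⟩
  have h1 : ∀ y : LinearMap.range f, f (s y) = (y : m → ℝ) := fun y =>
    congrArg Subtype.val (LinearMap.congr_fun hs y)
  have h2 : ∀ y : LinearMap.range f, p (y : m → ℝ) = y := fun y => LinearMap.congr_fun hp y
  apply Matrix.toLin'.injective
  rw [Matrix.toLin'_mul, Matrix.toLin'_mul, Matrix.toLin'_toMatrix', Matrix.toLin'_toMatrix',
    Matrix.toLin'_one]
  refine LinearMap.ext fun v => ?_
  change φ (p (f (s (φ.symm v)))) = v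
  rw [h1, h2, LinearEquiv.apply_symm_apply]

end LinearAlgebra

/-! ### Multilinear rank and the orbit of the base tensor -/

section Rank

variable {d : ℕ} {n : Fin d → ℕ} {r : ℕ}

theorem cpRank_sum_outer_le {s : ℕ} (v : Fin s → ∀ i, Fin (n i) → ℝ) :
    cpRank (∑ j, outer (v j)) ≤ s :=
  Nat.sInf_le ⟨v, rfl⟩

theorem outer_update_smul [DecidableEq (Fin d)] (v : ∀ i, Fin (n i) → ℝ) (i : Fin d) (c : ℝ) :
    outer (update v i (c • v i)) = c • outer v := by
  funext k
  simp only [outer, Pi.smul_apply, smul_eq_mul]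
  rw [Fintype.prod_eq_mul_prod_subtype_ne _ i, Fintype.prod_eq_mul_prod_subtype_ne _ i,
    ← mul_assoc]
  congr 1
  · simp
  · exact Finset.prod_congr rfl fun l _ => by rw [update_of_ne l.2]

/-- Every tensor with at least one factor is a sum of `cpRank T` rank-one tensors; without factors
this fails, since scalars other than `1` are not rank-one tensors. -/
theorem exists_eq_sum_outer (i₀ : Fin d) (T : Tensor n) :
    ∃ v : Fin (cpRank T) → ∀ i, Fin (n i) → ℝ, T = ∑ j, outer (v j) := by
  refine Nat.sInf_mem (s := {r | ∃ v : Fin r → ∀ i, Fin (n i) → ℝ, T = ∑ j, outer (v j)}) ?_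
  let e := Fintype.equivFin (∀ i, Fin (n i))
  let w : (∀ i, Fin (n i)) → ∀ i, Fin (n i) → ℝ := fun k i => Pi.single (k i) 1
  refine ⟨Fintype.card (∀ i, Fin (n i)), fun j =>
    update (w (e.symm j)) i₀ (T (e.symm j) • w (e.symm j) i₀), ?_⟩
  simp only [outer_update_smul]
  rw [Equiv.sum_comp e.symm (fun k => T k • outer (w k))]
  funext l
  have hw : ∀ k, outer (w k) l = if l = k then 1 else 0 := by
    intro k
    simp only [outer, w, Pi.single_apply]
    exact prod_ite_eq l k
  simp [Finset.sum_apply, hw]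

theorem piSplitAt_symm_same (i : Fin d) (a : Fin (n i)) (b : ∀ l : {l // l ≠ i}, Fin (n l)) :
    (Equiv.piSplitAt i fun l => Fin (n l)).symm (a, b) i = a := by
  simp [Equiv.piSplitAt]

theorem piSplitAt_symm_ne (i : Fin d) (a : Fin (n i)) (b : ∀ l : {l // l ≠ i}, Fin (n l))
    (l : {l // l ≠ i}) : (Equiv.piSplitAt i fun l => Fin (n l)).symm (a, b) l = b l := by
  simp [Equiv.piSplitAt, l.2]

theorem prod_piSplitAt_symm (f : ∀ i, Fin (n i) → ℝ) (i : Fin d) (a : Fin (n i))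
    (b : ∀ l : {l // l ≠ i}, Fin (n l)) :
    ∏ l, f l ((Equiv.piSplitAt i fun l => Fin (n l)).symm (a, b) l) =
      f i a * ∏ l : {l // l ≠ i}, f l (b l) := by
  rw [Fintype.prod_eq_mul_prod_subtype_ne _ i, piSplitAt_symm_same]
  congr 1
  exact Finset.prod_congr rfl fun l _ => by rw [piSplitAt_symm_ne]

theorem flattening_sum_outer {s : ℕ} (v : Fin s → ∀ i, Fin (n i) → ℝ) (i : Fin d) :
    flattening (∑ j, outer (v j)) i =
      (Matrix.of fun b j => ∏ l : {l // l ≠ i}, v j l (b l)) * Matrix.of fun j => v j i := by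
  ext b a
  simp only [flattening, Matrix.of_apply, Finset.sum_apply, outer, Matrix.mul_apply]
  exact Finset.sum_congr rfl fun j _ => by rw [prod_piSplitAt_symm (v j), mul_comm]

theorem rank_flattening_sum_outer_le {s : ℕ} (v : Fin s → ∀ i, Fin (n i) → ℝ) (i : Fin d) :
    (flattening (∑ j, outer (v j)) i).rank ≤ s := by
  rw [flattening_sum_outer]
  exact (Matrix.rank_mul_le_left _ _).trans ((Matrix.rank_le_card_width _).trans_eq
    (Fintype.card_fin s))

theorem rank_flattening_le_cpRank (T : Tensor n) (i : Fin d) :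
    (flattening T i).rank ≤ cpRank T := by
  obtain ⟨v, hv⟩ := exists_eq_sum_outer i T
  conv_lhs => rw [hv]
  exact rank_flattening_sum_outer_le v i

/-- If a flattening of a sum of `r` rank-one tensors has rank `r`, then the vectors in the
corresponding factor are linearly independent. -/
theorem linearIndependent_of_rank_flattening {v : Fin r → ∀ i, Fin (n i) → ℝ} {i : Fin d}
    (h : (flattening (∑ j, outer (v j)) i).rank = r) : LinearIndependent ℝ fun j => v j i := by
  rw [flattening_sum_outer] at h
  refine linearIndependent_row_of_rank_eq (A := Matrix.of fun j => v j i)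
    (le_antisymm ?_ (h.symm.le.trans (Matrix.rank_mul_le_right _ _)))
  exact (Matrix.rank_le_card_height _).trans_eq (Fintype.card_fin r)

theorem flattening_smul (g : G n) (T : Tensor n) (i : Fin d) :
    flattening (g • T) i =
      (Matrix.of fun b b' : ∀ l : {l // l ≠ i}, Fin (n l) =>
        ∏ l : {l // l ≠ i}, comp g l (b l) (b' l)) * flattening T i *
        (comp g i).transpose := by
  ext b a
  simp only [flattening, Matrix.of_apply, Matrix.mul_apply, smul_apply, Matrix.transpose_apply]
  rw [← Equiv.sum_comp (Equiv.piSplitAt i fun l => Fin (n l)).symm, Fintype.sum_prod_type]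
  refine Finset.sum_congr rfl fun a' _ => ?_
  rw [Finset.sum_mul]
  refine Finset.sum_congr rfl fun b' _ => ?_
  have := prod_piSplitAt_symm (fun l c =>
    comp g l c ((Equiv.piSplitAt i fun l => Fin (n l)).symm (a', b') l)) i a b
  rw [this, piSplitAt_symm_same]
  simp only [piSplitAt_symm_ne]
  ring

theorem rank_flattening_smul (g : G n) (T : Tensor n) (i : Fin d) :
    (flattening (g • T) i).rank = (flattening T i).rank := by
  have h : ∀ (g : G n) (T : Tensor n), (flattening (g • T) i).rank ≤ (flattening T i).rank := by
    intro g T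
    rw [flattening_smul]
    exact (Matrix.rank_mul_le_left _ _).trans (Matrix.rank_mul_le_right _ _)
  refine le_antisymm (h g T) ?_
  conv_lhs => rw [← inv_smul_smul g T]
  exact h g⁻¹ (g • T)

theorem rank_flattening_baseTensor (hd : 2 ≤ d) (hr : ∀ i, r ≤ n i) (i : Fin d) :
    (flattening (baseTensor n r) i).rank = r := by
  refine le_antisymm (rank_flattening_sum_outer_le _ i) ?_
  have hsub : (flattening (baseTensor n r) i).submatrix
      (fun j : Fin r => fun l : {l // l ≠ i} => diagIdx hr j l) (fun j => diagIdx hr j i) = 1 := by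
    have : Nontrivial (Fin d) := Fin.nontrivial_iff_two_le.mpr hd
    obtain ⟨i', hi'⟩ := exists_ne i
    ext j j'
    rw [Matrix.submatrix_apply, baseTensor_eq, flattening_sum_outer, Matrix.mul_apply]
    simp only [Matrix.of_apply, Matrix.one_apply]
    rw [Finset.sum_eq_single j]
    · change (∏ l : {l // l ≠ i}, stdVec n j l (diagIdx hr j l)) *
        stdVec n j i (diagIdx hr j' i) = _
      simp [stdVec_apply hr, diagIdx_inj, eq_comm]
    · intro j'' _ hj''
      refine mul_eq_zero_of_left (Finset.prod_eq_zero (Finset.mem_univ ⟨i', hi'⟩) ?_) _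
      change stdVec n j'' i' (diagIdx hr j i') = 0
      simp [stdVec_apply hr, diagIdx_inj, hj''.symm]
    · simp
  calc r = (1 : Matrix (Fin r) (Fin r) ℝ).rank := by rw [Matrix.rank_one, Fintype.card_fin]
    _ ≤ _ := hsub ▸ Matrix.rank_submatrix_le _ _ _

theorem smul_baseTensor_mem_SigmaSet (hd : 2 ≤ d) (hr : ∀ i, r ≤ n i) (g : G n) :
    g • baseTensor n r ∈ SigmaSet n r := by
  have h : multilinearRank (g • baseTensor n r) = fun _ => r := funext fun i =>
    (rank_flattening_smul g _ i).trans (rank_flattening_baseTensor hd hr i)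
  refine ⟨le_antisymm ?_ ?_, h⟩
  · rw [smul_baseTensor hr]
    exact cpRank_sum_outer_le _
  · have := rank_flattening_le_cpRank (g • baseTensor n r) ⟨0, by omega⟩
    rwa [rank_flattening_smul, rank_flattening_baseTensor hd hr] at this

/-- Families of `r` linearly independent vectors in each factor are the first columns of an element
of `G`. -/
theorem exists_cols_eq (hr : ∀ i, r ≤ n i) {v : Fin r → ∀ i, Fin (n i) → ℝ}
    (hv : ∀ i, LinearIndependent ℝ fun j => v j i) :
    ∃ g : G n, ∀ j, cols hr (comp g) j = v j := by
  choose A hA hAv using fun i => exists_isUnit_col_eq (hr i) (hv i)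
  refine ⟨(equivProdGL n).symm fun i => (hA i).unit, fun j => ?_⟩
  funext i a
  have : comp ((equivProdGL n).symm fun i => (hA i).unit) i = A i := by
    rw [← coe_equivProdGL, MulEquiv.apply_symm_apply]; rfl
  rw [cols, this, diagIdx_apply, hAv]

/-- A sum of `r` rank-one tensors whose vectors are linearly independent in each factor lies in the
orbit of the base tensor. -/
theorem exists_smul_baseTensor_eq (hr : ∀ i, r ≤ n i) {v : Fin r → ∀ i, Fin (n i) → ℝ}
    (hv : ∀ i, LinearIndependent ℝ fun j => v j i) :
    ∃ g : G n, g • baseTensor n r = ∑ j, outer (v j) := by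
  obtain ⟨g, hg⟩ := exists_cols_eq hr hv
  exact ⟨g, by simp only [smul_baseTensor hr, hg]⟩

theorem SigmaSet_eq_orbit (hd : 2 ≤ d) (hr : ∀ i, r ≤ n i) :
    SigmaSet n r = MulAction.orbit (G n) (baseTensor n r) := by
  ext T
  constructor
  · rintro ⟨hT, hm⟩
    obtain ⟨v, hv⟩ := exists_eq_sum_outer ⟨0, by omega⟩ T
    subst hT
    obtain ⟨g, hg⟩ := exists_smul_baseTensor_eq hr (v := v) fun i => by
      refine linearIndependent_of_rank_flattening ?_
      rw [← hv]
      exact congrFun hm i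
    exact ⟨g, hg.trans hv.symm⟩
  · rintro ⟨g, rfl⟩
    exact smul_baseTensor_mem_SigmaSet hd hr g

end Rank

/-! ### Openness and density -/

section Topology

variable {d : ℕ} {n : Fin d → ℕ} {r : ℕ}

/-- The flattening of the generic tensor, whose entries are the coordinate functions. -/
def genericFlattening (n : Fin d → ℕ) (i : Fin d) :
    Matrix (∀ j : {j : Fin d // j ≠ i}, Fin (n j)) (Fin (n i)) (MvPolynomial (∀ i, Fin (n i)) ℝ) :=
  Matrix.of fun b a => MvPolynomial.X ((Equiv.piSplitAt i fun j => Fin (n j)).symm (a, b))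

/-- The determinant of an `r × r` compression of the `i`-th flattening, as a polynomial in the
entries of the tensor. -/
def compressionDet {i : Fin d} (X : Matrix (Fin r) (∀ j : {j : Fin d // j ≠ i}, Fin (n j)) ℝ)
    (Y : Matrix (Fin (n i)) (Fin r) ℝ) : MvPolynomial (∀ i, Fin (n i)) ℝ :=
  (X.map (MvPolynomial.C (σ := ∀ i, Fin (n i))) * genericFlattening n i *
    Y.map (MvPolynomial.C (σ := ∀ i, Fin (n i)))).det

theorem eval_compressionDet {i : Fin d}
    (X : Matrix (Fin r) (∀ j : {j : Fin d // j ≠ i}, Fin (n j)) ℝ)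
    (Y : Matrix (Fin (n i)) (Fin r) ℝ) (T : Tensor n) :
    MvPolynomial.eval T (compressionDet X Y) = (X * flattening T i * Y).det := by
  rw [compressionDet, RingHom.map_det]
  congr 1
  have hX : (X.map (MvPolynomial.C (σ := ∀ i, Fin (n i)))).map (MvPolynomial.eval T) = X := by
    ext; simp
  have hY : (Y.map (MvPolynomial.C (σ := ∀ i, Fin (n i)))).map (MvPolynomial.eval T) = Y := by
    ext; simp
  have hF : (genericFlattening n i).map (MvPolynomial.eval T) = flattening T i := by
    ext; simp [genericFlattening, flattening]
  rw [RingHom.mapMatrix_apply, Matrix.map_mul, Matrix.map_mul, hX, hY, hF]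

/-- Among the tensors of CP rank `r`, those of multilinear rank `(r, …, r)` form a relatively
Zariski open subset, defined by products of determinants of compressions of the flattenings. -/
theorem SigmaSet_eq_eval_ne_zero :
    SigmaSet n r = {T | T ∈ rankSet n r ∧ ∃ p ∈ {p : MvPolynomial (∀ i, Fin (n i)) ℝ |
      ∃ (X : ∀ i, Matrix (Fin r) (∀ j : {j : Fin d // j ≠ i}, Fin (n j)) ℝ)
        (Y : ∀ i, Matrix (Fin (n i)) (Fin r) ℝ), p = ∏ i, compressionDet (X i) (Y i)},
      MvPolynomial.eval T p ≠ 0} := by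
  ext T
  refine and_congr_right fun hT => ?_
  constructor
  · intro hm
    have h : ∀ i, ∃ (X : Matrix (Fin r) (∀ j : {j : Fin d // j ≠ i}, Fin (n j)) ℝ)
        (Y : Matrix (Fin (n i)) (Fin r) ℝ), X * flattening T i * Y = 1 := by
      intro i
      have := exists_mul_mul_eq_one (flattening T i)
      have hi : (flattening T i).rank = r := congrFun hm i
      rwa [hi] at this
    choose X Y hXY using h
    refine ⟨_, ⟨X, Y, rfl⟩, ?_⟩
    simp [map_prod, eval_compressionDet, hXY]
  · rintro ⟨_, ⟨X, Y, rfl⟩, hp⟩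
    funext i
    rw [map_prod, Finset.prod_ne_zero_iff] at hp
    have hi := hp i (Finset.mem_univ i)
    rw [eval_compressionDet] at hi
    refine le_antisymm (hT ▸ rank_flattening_le_cpRank T i) ?_
    have hu := Matrix.rank_of_isUnit _ ((Matrix.isUnit_iff_isUnit_det _).mpr hi.isUnit)
    rw [Fintype.card_fin] at hu
    calc r = (X i * flattening T i * Y i).rank := hu.symm
      _ ≤ (flattening T i).rank :=
        (Matrix.rank_mul_le_left _ _).trans (Matrix.rank_mul_le_right _ _)

theorem isOpen_preimage_SigmaSet :
    IsOpen ((↑) ⁻¹' SigmaSet n r : Set (rankSet n r)) := by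
  rw [SigmaSet_eq_eval_ne_zero]
  have : ((↑) ⁻¹' {T | T ∈ rankSet n r ∧ ∃ p ∈ {p : MvPolynomial (∀ i, Fin (n i)) ℝ |
      ∃ (X : ∀ i, Matrix (Fin r) (∀ j : {j : Fin d // j ≠ i}, Fin (n j)) ℝ)
        (Y : ∀ i, Matrix (Fin (n i)) (Fin r) ℝ), p = ∏ i, compressionDet (X i) (Y i)},
      MvPolynomial.eval T p ≠ 0} : Set (rankSet n r)) =
      ⋃ p ∈ {p : MvPolynomial (∀ i, Fin (n i)) ℝ |
      ∃ (X : ∀ i, Matrix (Fin r) (∀ j : {j : Fin d // j ≠ i}, Fin (n j)) ℝ)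
        (Y : ∀ i, Matrix (Fin (n i)) (Fin r) ℝ), p = ∏ i, compressionDet (X i) (Y i)},
      {T : rankSet n r | MvPolynomial.eval (T : Tensor n) p ≠ 0} := by
    ext T
    simp
  rw [this]
  exact isOpen_biUnion fun p _ => isOpen_ne_fun
    ((MvPolynomial.continuous_eval p).comp continuous_subtype_val) continuous_const

/-- A family of vectors becomes linearly independent under small generic translations along the
standard basis: the relevant minor is a characteristic polynomial. -/
theorem eventually_linearIndependent_add_smul {m : ℕ} (hr : r ≤ m) (v : Fin r → Fin m → ℝ) :
    ∀ᶠ t in 𝓝[≠] (0 : ℝ), LinearIndependent ℝ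
      fun j => v j + t • (Pi.single (Fin.castLE hr j) 1 : Fin m → ℝ) := by
  set B : Matrix (Fin r) (Fin r) ℝ := -Matrix.of fun j a => v j (Fin.castLE hr a) with hB
  have hfin : {t : ℝ | B.charpoly.IsRoot t}.Finite :=
    Polynomial.finite_setOfPred_isRoot (B.charpoly_monic.ne_zero)
  have hev : ∀ᶠ t in 𝓝[≠] (0 : ℝ), ¬ B.charpoly.IsRoot t := by
    have h1 : ∀ᶠ t in 𝓝[≠] (0 : ℝ), t ∉ {t : ℝ | B.charpoly.IsRoot t} \ {0} := by
      exact mem_nhdsWithin_of_mem_nhds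
        ((hfin.subset sdiff_subset).isClosed.isOpen_compl.mem_nhds (by simp))
    filter_upwards [h1, self_mem_nhdsWithin] with t ht ht0 hroot
    exact ht ⟨hroot, ht0⟩
  filter_upwards [hev] with t ht
  have hdet : (Matrix.of fun j a => (v j + t • (Pi.single (Fin.castLE hr j) 1 : Fin m → ℝ))
      (Fin.castLE hr a)).det ≠ 0 := by
    convert ht using 2
    rw [Polynomial.IsRoot, Matrix.eval_charpoly]
    congr! 2
    ext j a
    simp [hB, Matrix.diagonal_apply, Pi.single_apply, eq_comm, add_comm]
  have hli := Matrix.linearIndependent_rows_of_det_ne_zero hdet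
  exact LinearIndependent.of_comp (LinearMap.funLeft ℝ ℝ (Fin.castLE hr)) hli

theorem dense_preimage_SigmaSet (hd : 2 ≤ d) (hr : ∀ i, r ≤ n i) :
    Dense ((↑) ⁻¹' SigmaSet n r : Set (rankSet n r)) := by
  rintro ⟨T, hT⟩
  obtain ⟨v, hv⟩ := exists_eq_sum_outer ⟨0, by omega⟩ T
  have hT' : cpRank T = r := hT
  subst hT'
  set w : ℝ → Fin (cpRank T) → ∀ i, Fin (n i) → ℝ := fun t j i =>
    v j i + t • (Pi.single (Fin.castLE (hr i) j) 1 : Fin (n i) → ℝ) with hw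
  have hmem : ∀ᶠ t in 𝓝[≠] (0 : ℝ), ∑ j, outer (w t j) ∈ SigmaSet n (cpRank T) := by
    have : ∀ᶠ t in 𝓝[≠] (0 : ℝ), ∀ i, LinearIndependent ℝ fun j => w t j i :=
      eventually_all.mpr fun i => eventually_linearIndependent_add_smul (hr i) fun j => v j i
    filter_upwards [this] with t ht
    obtain ⟨g, hg⟩ := exists_smul_baseTensor_eq hr ht
    exact hg ▸ smul_baseTensor_mem_SigmaSet hd hr g
  have hlim : Tendsto (fun t => ∑ j, outer (w t j)) (𝓝[≠] (0 : ℝ)) (𝓝 T) := by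
    have hc : Continuous fun t => ∑ j, outer (w t j) := by
      simp only [hw]
      refine continuous_finsetSum _ fun j _ => continuous_pi fun k => ?_
      simp only [outer, Pi.add_apply, Pi.smul_apply]
      fun_prop
    have h0 : ∑ j, outer (w 0 j) = T := by
      refine Eq.trans ?_ hv.symm
      simp [hw]
    have h1 := hc.tendsto 0
    rw [h0] at h1
    exact h1.mono_left nhdsWithin_le_nhds
  rw [closure_subtype]
  refine mem_closure_of_tendsto hlim ?_
  filter_upwards [hmem] with t ht
  exact ⟨⟨_, ht.1⟩, ht, rfl⟩

end Topology

/-! ### Perturbation of eigenvectors -/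

section Perturbation

variable {ι : Type*} {l : Filter ι} {r : ℕ}

theorem tendsto_matrix_inv {A : ι → Matrix (Fin r) (Fin r) ℝ} (hA : Tendsto A l (𝓝 1)) :
    Tendsto (fun k => (A k)⁻¹) l (𝓝 1) := by
  have hdet : Tendsto (fun k => (A k).det) l (𝓝 1) := by
    have := ((continuous_id (X := Matrix (Fin r) (Fin r) ℝ)).matrix_det.tendsto 1).comp hA
    rwa [id, Matrix.det_one] at this
  have hadj : Tendsto (fun k => (A k).adjugate) l (𝓝 1) := by
    have := ((continuous_id (X := Matrix (Fin r) (Fin r) ℝ)).matrix_adjugate.tendsto 1).comp hA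
    rwa [id, Matrix.adjugate_one] at this
  have := (hdet.inv₀ one_ne_zero).smul hadj
  simp only [inv_one, one_smul] at this
  simpa only [Matrix.inv_def, Ring.inverse_eq_inv'] using this

theorem tendsto_matrix_iff {m k : Type*} {A : ι → Matrix m k ℝ} {B : Matrix m k ℝ} :
    Tendsto A l (𝓝 B) ↔ ∀ a b, Tendsto (fun x => A x a b) l (𝓝 (B a b)) := by
  refine Iff.trans (tendsto_pi_nhds (f := fun x a => A x a) (g := fun a => B a)) ?_
  exact forall_congr' fun a => tendsto_pi_nhds

/-- The eigenvalues of a diagonalisable matrix close to a diagonal matrix are close to its diagonal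
entries: the characteristic polynomial takes small values at the latter. -/
theorem tendsto_eigenvalue {C U : ι → Matrix (Fin r) (Fin r) ℝ} {β : ι → Fin r → ℝ}
    {lam : Fin r → ℝ} (hC : Tendsto C l (𝓝 (Matrix.diagonal lam)))
    (hU : ∀ᶠ k in l, (U k).det ≠ 0)
    (hCU : ∀ᶠ k in l, C k * U k = U k * Matrix.diagonal (β k)) :
    ∃ t : ι → Fin r → Fin r, ∀ j, Tendsto (fun k => β k (t k j)) l (𝓝 (lam j)) := by
  have hmin : ∀ (k : ι) (j : Fin r), ∃ j₀, ∀ j', |lam j - β k j₀| ≤ |lam j - β k j'| := by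
    intro k j
    have : Nonempty (Fin r) := ⟨j⟩
    exact Finite.exists_min fun j' => |lam j - β k j'|
  choose t ht using hmin
  refine ⟨t, fun j => ?_⟩
  have hdet : Tendsto (fun k => (Matrix.scalar (Fin r) (lam j) - C k).det) l (𝓝 0) := by
    have h1 : Continuous fun M : Matrix (Fin r) (Fin r) ℝ =>
        (Matrix.scalar (Fin r) (lam j) - M).det := (continuous_const.sub continuous_id).matrix_det
    have h2 := (h1.tendsto (Matrix.diagonal lam)).comp hC
    have h3 : (Matrix.scalar (Fin r) (lam j) - Matrix.diagonal lam).det = 0 := by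
      rw [Matrix.scalar_apply, Matrix.diagonal_sub, Matrix.det_diagonal]
      exact Finset.prod_eq_zero (Finset.mem_univ j) (sub_self _)
    rw [h3] at h2
    exact h2
  have hprod : ∀ᶠ k in l, (Matrix.scalar (Fin r) (lam j) - C k).det = ∏ j', (lam j - β k j') := by
    filter_upwards [hU, hCU] with k hk1 hk2
    have h1 : (Matrix.scalar (Fin r) (lam j) - C k) * U k =
        U k * Matrix.diagonal fun j' => lam j - β k j' := by
      rw [sub_mul, hk2, ← Matrix.diagonal_sub, mul_sub]
      congr 1
      exact (Matrix.scalar_commute (lam j) (fun _ => mul_comm _ _) (U k)).eq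
    have h2 := congrArg Matrix.det h1
    rw [Matrix.det_mul, Matrix.det_mul, mul_comm, Matrix.det_diagonal] at h2
    exact mul_left_cancel₀ hk1 h2
  rw [Metric.tendsto_nhds]
  intro ε hε
  have hsmall := (Metric.tendsto_nhds.mp hdet) (ε ^ r) (pow_pos hε r)
  filter_upwards [hsmall, hprod] with k hk1 hk2
  rw [Real.dist_eq, abs_sub_comm]
  by_contra hcon
  rw [hk2, Real.dist_eq, sub_zero, Finset.abs_prod] at hk1
  have h3 : ∏ _j' : Fin r, ε ≤ ∏ j', |lam j - β k j'| :=
    Finset.prod_le_prod (fun _ _ => hε.le) fun j' _ => (not_lt.mp hcon).trans (ht k j j')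
  rw [Finset.prod_const, Finset.card_univ, Fintype.card_fin] at h3
  exact absurd hk1 (not_lt.mpr h3)

/-- An eigenvector of a matrix close to a diagonal matrix with distinct entries, whose eigenvalue is
close to the `j`-th one, is close to a multiple of the `j`-th standard basis vector. -/
theorem tendsto_eigenvector {C : ι → Matrix (Fin r) (Fin r) ℝ} {x : ι → Fin r → ℝ} {β : ι → ℝ}
    {lam : Fin r → ℝ} (hlam : Injective lam) (hC : Tendsto C l (𝓝 (Matrix.diagonal lam)))
    (hx : ∀ᶠ k in l, x k ≠ 0) (hCx : ∀ᶠ k in l, (C k).mulVec (x k) = β k • x k)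
    {j : Fin r} (hβ : Tendsto β l (𝓝 (lam j))) :
    (∀ᶠ k in l, x k j ≠ 0) ∧
      ∀ a, Tendsto (fun k => x k a / x k j) l (𝓝 (if a = j then 1 else 0)) := by
  have hmax : ∀ k, ∃ a, ∀ b, |x k b| ≤ |x k a| := by
    intro k
    have : Nonempty (Fin r) := ⟨j⟩
    exact Finite.exists_max fun b => |x k b|
  choose μ hμ using hmax
  -- The entries of `C - diagonal lam` and their row sums tend to `0`.
  set R : ι → Fin r → ℝ := fun k a => ∑ b, |Matrix.diagonal lam a b - C k a b| with hR
  have hR0 : ∀ a, Tendsto (fun k => R k a) l (𝓝 0) := by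
    intro a
    have h1 : ∀ b, Tendsto (fun k => |Matrix.diagonal lam a b - C k a b|) l (𝓝 0) := by
      intro b
      have := (tendsto_const_nhds (x := Matrix.diagonal lam a b)).sub
        (tendsto_matrix_iff.mp hC a b)
      simpa using this.abs
    simpa using tendsto_finsetSum Finset.univ fun b _ => h1 b
  have hkey : ∀ᶠ k in l, ∀ a, |lam a - β k| * |x k a| ≤ R k a * |x k (μ k)| := by
    filter_upwards [hCx] with k hk a
    have h1 : (lam a - β k) * x k a = ∑ b, (Matrix.diagonal lam a b - C k a b) * x k b := by
      have h2 : ∑ b, C k a b * x k b = β k * x k a := congrFun hk a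
      simp only [sub_mul, Finset.sum_sub_distrib, h2]
      simp [Matrix.diagonal_apply]
    rw [← abs_mul, h1, Finset.sum_mul]
    refine (Finset.abs_sum_le_sum_abs _ _).trans (Finset.sum_le_sum fun b _ => ?_)
    rw [abs_mul]
    exact mul_le_mul_of_nonneg_left (hμ k b) (abs_nonneg _)
  have hgap : ∀ a, Tendsto (fun k => |lam a - β k|) l (𝓝 |lam a - lam j|) := fun a =>
    (tendsto_const_nhds.sub hβ).abs
  have hpos : ∀ a, a ≠ j → 0 < |lam a - lam j| := fun a ha =>
    abs_pos.mpr (sub_ne_zero.mpr fun h => ha (hlam h))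
  have hμx : ∀ᶠ k in l, x k (μ k) ≠ 0 := by
    filter_upwards [hx] with k hk h0
    refine hk (funext fun b => ?_)
    have := hμ k b
    rw [h0, abs_zero] at this
    exact abs_nonpos_iff.mp this
  have hμj : ∀ᶠ k in l, μ k = j := by
    have h1 : ∀ᶠ k in l, ∀ a, a ≠ j → R k a < |lam a - β k| := by
      refine eventually_all.mpr fun a => ?_
      by_cases ha : a = j
      · exact Eventually.of_forall fun k h => absurd ha h
      · filter_upwards [(hR0 a).eventually_lt (hgap a) (hpos a ha)] with k hk _ using hk
    filter_upwards [h1, hkey, hμx] with k hk1 hk2 hk3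
    by_contra hne
    exact absurd (hk2 (μ k)) (not_le.mpr (mul_lt_mul_of_pos_right (hk1 _ hne) (abs_pos.mpr hk3)))
  have hxj : ∀ᶠ k in l, x k j ≠ 0 := by
    filter_upwards [hμj, hμx] with k hk1 hk2
    rwa [← hk1]
  refine ⟨hxj, fun a => ?_⟩
  split_ifs with ha
  · subst ha
    refine tendsto_const_nhds.congr' ?_
    filter_upwards [hxj] with k hk
    exact (div_self hk).symm
  · have hlim : Tendsto (fun k => R k a / |lam a - β k|) l (𝓝 0) := by
      have := (hR0 a).div (hgap a) (hpos a ha).ne'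
      rwa [zero_div] at this
    refine squeeze_zero_norm' ?_ hlim
    filter_upwards [hkey, hμj, hxj, (hgap a).eventually (lt_mem_nhds (hpos a ha))]
      with k hk1 hk2 hk3 hk4
    have := hk1 a
    rw [hk2] at this
    rw [Real.norm_eq_abs, abs_div, div_le_div_iff₀ (abs_pos.mpr hk3) hk4, mul_comm]
    exact this

/-- A diagonalisable matrix close to a diagonal matrix with distinct entries has, up to order and
scale, a basis of eigenvectors close to the standard basis. -/
theorem exists_perm_tendsto_eigenvector {C U : ι → Matrix (Fin r) (Fin r) ℝ} {β : ι → Fin r → ℝ}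
    {lam : Fin r → ℝ} (hlam : Injective lam) (hC : Tendsto C l (𝓝 (Matrix.diagonal lam)))
    (hU : ∀ᶠ k in l, (U k).det ≠ 0)
    (hCU : ∀ᶠ k in l, C k * U k = U k * Matrix.diagonal (β k)) :
    ∃ τ : ι → Equiv.Perm (Fin r), ∀ j, (∀ᶠ k in l, U k j (τ k j) ≠ 0) ∧
      ∀ a, Tendsto (fun k => U k a (τ k j) / U k j (τ k j)) l (𝓝 (if a = j then 1 else 0)) := by
  classical
  obtain ⟨t, ht⟩ := tendsto_eigenvalue hC hU hCU
  have hinj : ∀ᶠ k in l, Injective (t k) := by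
    have h1 : ∀ᶠ k in l, ∀ j j', j ≠ j' → β k (t k j) ≠ β k (t k j') := by
      refine eventually_all.mpr fun j => eventually_all.mpr fun j' => ?_
      by_cases h : j = j'
      · exact Eventually.of_forall fun k h' => absurd h h'
      · filter_upwards [((ht j).sub (ht j')).eventually_ne (sub_ne_zero.mpr (hlam.ne h))]
          with k hk _ using sub_ne_zero.mp hk
    filter_upwards [h1] with k hk j j' hjj
    by_contra h
    exact hk j j' h (by rw [hjj])
  let τ : ι → Equiv.Perm (Fin r) := fun k =>
    if h : Injective (t k) then Equiv.ofBijective (t k) (Finite.injective_iff_bijective.mp h) else 1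
  have hτ : ∀ᶠ k in l, ∀ j, τ k j = t k j := by
    filter_upwards [hinj] with k hk j
    simp [τ, hk]
  refine ⟨τ, fun j => ?_⟩
  refine tendsto_eigenvector (x := fun k a => U k a (τ k j)) (β := fun k => β k (τ k j)) hlam hC
    ?_ ?_ ((ht j).congr' ?_)
  · filter_upwards [hU] with k hk h0
    exact hk (Matrix.det_eq_zero_of_column_eq_zero (τ k j) fun a => congrFun h0 a)
  · filter_upwards [hCU] with k hk
    funext a
    have := congrFun (congrFun hk a) (τ k j)
    rw [Matrix.mul_diagonal, mul_comm] at this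
    exact this
  · filter_upwards [hτ] with k hk
    rw [hk]

end Perturbation

/-! ### Uniqueness and continuity of the CP decomposition -/

section Decomposition

variable {ι : Type*} {l : Filter ι} {d : ℕ} {n : Fin d → ℕ} {r : ℕ}

theorem outer_update (u : ∀ i, Fin (n i) → ℝ) (x : ∀ i, Fin (n i)) (i : Fin d) (a : Fin (n i)) :
    outer u (update x i a) = u i a * ∏ i' ∈ Finset.univ \ {i}, u i' (x i') := by
  have h : ∀ i', u i' (update x i a i') = update (fun i' => u i' (x i')) i (u i a) i' := fun i' =>
    Function.apply_update (fun i' => u i') x i a i'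
  simp only [outer, h]
  exact Finset.prod_update_of_mem (Finset.mem_univ i) _ _

theorem outer_update_update (u : ∀ i, Fin (n i) → ℝ) (x : ∀ i, Fin (n i)) {i₀ i₁ : Fin d}
    (h01 : i₁ ≠ i₀) (a : Fin (n i₀)) (b : Fin (n i₁)) :
    outer u (update (update x i₁ b) i₀ a) =
      u i₀ a * (u i₁ b * ∏ i ∈ (Finset.univ \ {i₀}) \ {i₁}, u i (x i)) := by
  rw [outer_update]
  have h : ∀ i, u i (update x i₁ b i) = update (fun i => u i (x i)) i₁ (u i₁ b) i := fun i =>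
    Function.apply_update (fun i => u i) x i₁ b i
  simp only [h]
  rw [Finset.prod_update_of_mem (by simp [h01])]

/-- The contraction of a tensor to a matrix in the factors `i₀` and `i₁`, with weights `w` on the
diagonal positions of the other factors. Its columns are restricted to the first `r`. -/
def contraction (hr : ∀ i, r ≤ n i) (i₀ i₁ : Fin d) (w : Fin r → ℝ) (T : Tensor n) :
    Matrix (Fin (n i₀)) (Fin r) ℝ :=
  Matrix.of fun a b =>
    ∑ c, w c * T (update (update (diagIdx hr c) i₁ (diagIdx hr b i₁)) i₀ a)

/-- The weight with which a rank-one tensor enters a contraction. -/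
def contractionWeight (hr : ∀ i, r ≤ n i) (i₀ i₁ : Fin d) (w : Fin r → ℝ)
    (u : ∀ i, Fin (n i) → ℝ) : ℝ :=
  ∑ c, w c * ∏ i ∈ (Finset.univ \ {i₀}) \ {i₁}, u i (diagIdx hr c i)

theorem contraction_sum_outer (hr : ∀ i, r ≤ n i) {i₀ i₁ : Fin d} (h01 : i₁ ≠ i₀)
    (w : Fin r → ℝ) (u : Fin r → ∀ i, Fin (n i) → ℝ) :
    contraction hr i₀ i₁ w (∑ j, outer (u j)) =
      (Matrix.of fun a j => u j i₀ a) *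
        Matrix.diagonal (fun j => contractionWeight hr i₀ i₁ w (u j)) *
        Matrix.of fun j b => u j i₁ (diagIdx hr b i₁) := by
  ext a b
  rw [Matrix.mul_apply]
  simp only [contraction, contractionWeight, Matrix.of_apply,
    Matrix.mul_diagonal, Finset.sum_apply, outer_update_update _ _ h01, Finset.mul_sum,
    Finset.sum_mul]
  rw [Finset.sum_comm]
  exact Finset.sum_congr rfl fun j _ => Finset.sum_congr rfl fun c _ => by ring

theorem contraction_baseTensor (hr : ∀ i, r ≤ n i) {i₀ i₁ i₂ : Fin d} (h01 : i₁ ≠ i₀)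
    (h02 : i₂ ≠ i₀) (h12 : i₂ ≠ i₁) (w : Fin r → ℝ) :
    contraction hr i₀ i₁ w (baseTensor n r) =
      Matrix.of fun a b => if a = diagIdx hr b i₀ then w b else 0 := by
  have hw : ∀ j, contractionWeight hr i₀ i₁ w (stdVec n j) = w j := by
    intro j
    rw [contractionWeight, Finset.sum_eq_single j]
    · rw [Finset.prod_eq_one, mul_one]
      intro i _
      simp [stdVec_apply hr]
    · intro c _ hc
      refine mul_eq_zero_of_right _ (Finset.prod_eq_zero (i := i₂) (by simp [h02, h12]) ?_)
      simp [stdVec_apply hr, diagIdx_inj, hc]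
    · simp
  rw [baseTensor_eq, contraction_sum_outer hr h01]
  simp only [hw]
  ext a b
  rw [Matrix.mul_apply]
  simp only [Matrix.mul_diagonal, Matrix.of_apply, stdVec_apply hr, diagIdx_inj]
  simp

theorem tendsto_contraction (hr : ∀ i, r ≤ n i) (i₀ i₁ : Fin d) (w : Fin r → ℝ)
    {T : ι → Tensor n} {T₀ : Tensor n} (hT : Tendsto T l (𝓝 T₀)) :
    Tendsto (fun k => contraction hr i₀ i₁ w (T k)) l (𝓝 (contraction hr i₀ i₁ w T₀)) := by
  rw [tendsto_matrix_iff]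
  intro a b
  change Tendsto (fun k => ∑ c, w c *
    T k (update (update (diagIdx hr c) i₁ (diagIdx hr b i₁)) i₀ a)) l (𝓝 (∑ c, w c *
    T₀ (update (update (diagIdx hr c) i₁ (diagIdx hr b i₁)) i₀ a)))
  exact tendsto_finsetSum _ fun c _ => (tendsto_pi_nhds.mp hT _).const_mul _

/-- The vectors of one factor in a decomposition of a tensor close to the base tensor are close to
the standard basis vectors, up to order and scale: with three factors at hand, two contractions of
the tensor along the others are simultaneously diagonalised by these vectors. -/
theorem exists_perm_tendsto_factor (hr : ∀ i, r ≤ n i) {i₀ i₁ i₂ : Fin d} (h01 : i₁ ≠ i₀)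
    (h02 : i₂ ≠ i₀) (h12 : i₂ ≠ i₁) {u : ι → Fin r → ∀ i, Fin (n i) → ℝ}
    (hu : Tendsto (fun k => ∑ j, outer (u k j)) l (𝓝 (baseTensor n r))) :
    ∃ τ : ι → Equiv.Perm (Fin r), ∀ j, (∀ᶠ k in l, u k (τ k j) i₀ (diagIdx hr j i₀) ≠ 0) ∧
      ∀ a, Tendsto (fun k => u k (τ k j) i₀ a / u k (τ k j) i₀ (diagIdx hr j i₀)) l
        (𝓝 (if a = diagIdx hr j i₀ then 1 else 0)) := by
  set lam : Fin r → ℝ := fun j => (j : ℝ) with hlam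
  have hlaminj : Injective lam := fun j j' h => Fin.ext (Nat.cast_injective h)
  set A : ι → Matrix (Fin (n i₀)) (Fin r) ℝ := fun k =>
    contraction hr i₀ i₁ 1 (∑ j, outer (u k j)) with hA
  set B : ι → Matrix (Fin (n i₀)) (Fin r) ℝ := fun k =>
    contraction hr i₀ i₁ lam (∑ j, outer (u k j)) with hB
  -- `top` selects the top `r × r` block; those of `A` and `B` tend to `1` and `diagonal lam`.
  set top : Matrix (Fin (n i₀)) (Fin r) ℝ → Matrix (Fin r) (Fin r) ℝ := fun M =>
    M.submatrix (fun j => diagIdx hr j i₀) id with htop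
  set U : ι → Matrix (Fin (n i₀)) (Fin r) ℝ := fun k => Matrix.of fun a j => u k j i₀ a with hU
  set V : ι → Matrix (Fin r) (Fin r) ℝ := fun k =>
    Matrix.of fun j b => u k j i₁ (diagIdx hr b i₁) with hV
  set α : ι → Fin r → ℝ := fun k j => contractionWeight hr i₀ i₁ 1 (u k j) with hα
  set γ : ι → Fin r → ℝ := fun k j => contractionWeight hr i₀ i₁ lam (u k j) with hγ
  have hAU : ∀ k, A k = U k * Matrix.diagonal (α k) * V k := fun k =>
    contraction_sum_outer hr h01 1 (u k)
  have hBU : ∀ k, B k = U k * Matrix.diagonal (γ k) * V k := fun k =>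
    contraction_sum_outer hr h01 lam (u k)
  have hAlim := tendsto_contraction hr i₀ i₁ 1 hu
  have hBlim := tendsto_contraction hr i₀ i₁ lam hu
  rw [contraction_baseTensor hr h01 h02 h12] at hAlim hBlim
  have htopmul : ∀ (M : Matrix (Fin (n i₀)) (Fin r) ℝ) (N : Matrix (Fin r) (Fin r) ℝ),
      top (M * N) = top M * N := fun M N => rfl
  have hA' : Tendsto (fun k => top (A k)) l (𝓝 1) := by
    rw [tendsto_matrix_iff] at hAlim ⊢
    intro a b
    have : Tendsto (fun k => top (A k) a b) l (𝓝 _) := hAlim (diagIdx hr a i₀) b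
    simpa [diagIdx_inj, Matrix.one_apply] using this
  have hB' : Tendsto (fun k => top (B k)) l (𝓝 (Matrix.diagonal lam)) := by
    rw [tendsto_matrix_iff] at hBlim ⊢
    intro a b
    have : Tendsto (fun k => top (B k) a b) l (𝓝 _) := hBlim (diagIdx hr a i₀) b
    rw [Matrix.of_apply] at this
    rw [Matrix.diagonal_apply]
    by_cases hab : a = b
    · subst hab
      simpa using this
    · simpa [diagIdx_inj, hab] using this
  have hAinv := tendsto_matrix_inv hA'
  have hC : Tendsto (fun k => top (B k) * (top (A k))⁻¹) l (𝓝 (Matrix.diagonal lam)) := by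
    have := hB'.mul hAinv
    rwa [mul_one] at this
  have hdet : ∀ᶠ k in l, (top (A k)).det ≠ 0 := by
    have := ((continuous_id (X := Matrix (Fin r) (Fin r) ℝ)).matrix_det.tendsto 1).comp hA'
    rw [id, Matrix.det_one] at this
    exact this.eventually_ne one_ne_zero
  have hsplit : ∀ᶠ k in l, (top (U k)).det ≠ 0 ∧ (∀ j, α k j ≠ 0) ∧ (V k).det ≠ 0 := by
    filter_upwards [hdet] with k hk
    rw [hAU, htopmul, htopmul, Matrix.det_mul, Matrix.det_mul, Matrix.det_diagonal,
      mul_ne_zero_iff, mul_ne_zero_iff, Finset.prod_ne_zero_iff] at hk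
    exact ⟨hk.1.1, fun j => hk.1.2 j (Finset.mem_univ j), hk.2⟩
  -- As `A = U diag(α) V`, the columns of `top U` are eigenvectors of `top B * (top A)⁻¹`.
  have hAinvU : ∀ᶠ k in l,
      (top (A k))⁻¹ * top (U k) = (V k)⁻¹ * Matrix.diagonal (fun j => (α k j)⁻¹) := by
    filter_upwards [hdet, hsplit] with k hk1 ⟨_, hk2, hk3⟩
    have h1 : top (U k) = top (A k) * ((V k)⁻¹ * Matrix.diagonal (fun j => (α k j)⁻¹)) := by
      have h2 : Matrix.diagonal (α k) * Matrix.diagonal (fun j => (α k j)⁻¹) = 1 := by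
        rw [Matrix.diagonal_mul_diagonal, ← Matrix.diagonal_one]
        exact congrArg _ (funext fun j => mul_inv_cancel₀ (hk2 j))
      rw [hAU, htopmul, htopmul, Matrix.mul_assoc, ← Matrix.mul_assoc (V k),
        Matrix.mul_nonsing_inv _ hk3.isUnit, Matrix.one_mul, Matrix.mul_assoc, h2, Matrix.mul_one]
    rw [h1, ← Matrix.mul_assoc, Matrix.nonsing_inv_mul _ hk1.isUnit, Matrix.one_mul]
  obtain ⟨τ, hτ⟩ := exists_perm_tendsto_eigenvector (U := fun k => top (U k))
    (β := fun k j => γ k j * (α k j)⁻¹) hlaminj hC (hsplit.mono fun k hk => hk.1) (by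
      filter_upwards [hAinvU, hsplit] with k hk1 ⟨_, _, hk3⟩
      rw [Matrix.mul_assoc, hk1, hBU, htopmul, htopmul, Matrix.mul_assoc, ← Matrix.mul_assoc (V k),
        Matrix.mul_nonsing_inv _ hk3.isUnit, Matrix.one_mul, Matrix.mul_assoc,
        Matrix.diagonal_mul_diagonal])
  refine ⟨τ, fun j => ⟨(hτ j).1, fun a => ?_⟩⟩
  -- The remaining rows of `U` are recovered from its top block.
  have hUA : ∀ᶠ k in l, U k = A k * (top (A k))⁻¹ * top (U k) := by
    filter_upwards [hAinvU, hsplit] with k hk1 ⟨_, hk2, hk3⟩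
    have h2 : Matrix.diagonal (α k) * Matrix.diagonal (fun j => (α k j)⁻¹) = 1 := by
      rw [Matrix.diagonal_mul_diagonal, ← Matrix.diagonal_one]
      exact congrArg _ (funext fun j => mul_inv_cancel₀ (hk2 j))
    rw [Matrix.mul_assoc, hk1, hAU, Matrix.mul_assoc, ← Matrix.mul_assoc (V k),
      Matrix.mul_nonsing_inv _ hk3.isUnit, Matrix.one_mul, Matrix.mul_assoc, h2, Matrix.mul_one]
  have hAA : ∀ b, Tendsto (fun k => (A k * (top (A k))⁻¹) a b) l
      (𝓝 (if a = diagIdx hr b i₀ then 1 else 0)) := by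
    intro b
    have h1 := tendsto_finsetSum Finset.univ fun c (_ : c ∈ Finset.univ) =>
      (tendsto_matrix_iff.mp hAlim a c).mul (tendsto_matrix_iff.mp hAinv c b)
    simpa [Matrix.mul_apply, Matrix.one_apply] using h1
  have hsum := tendsto_finsetSum Finset.univ fun b (_ : b ∈ Finset.univ) =>
    (hAA b).mul ((hτ j).2 b)
  have hval : ∑ b, (if a = diagIdx hr b i₀ then (1 : ℝ) else 0) * (if b = j then 1 else 0) =
      if a = diagIdx hr j i₀ then 1 else 0 := by simp
  rw [hval] at hsum
  refine hsum.congr' ?_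
  filter_upwards [hUA] with k hk
  have h1 : u k (τ k j) i₀ a = ∑ b, (A k * (top (A k))⁻¹) a b * top (U k) b (τ k j) := by
    rw [← Matrix.mul_apply, ← hk]; rfl
  rw [h1, Finset.sum_div]
  exact Finset.sum_congr rfl fun b _ => by rw [mul_div_assoc]; rfl

/-- **Continuity of the CP decomposition at the base tensor**: for tensors with at least three
factors, the rank-one summands in a decomposition of a tensor close to the base tensor are close to
those of the base tensor, up to order. -/
theorem exists_perm_tendsto_outer (hd : 3 ≤ d) (hr : ∀ i, r ≤ n i)
    {u : ι → Fin r → ∀ i, Fin (n i) → ℝ}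
    (hu : Tendsto (fun k => ∑ j, outer (u k j)) l (𝓝 (baseTensor n r))) :
    ∃ τ : ι → Equiv.Perm (Fin r), ∀ j,
      Tendsto (fun k => outer (u k (τ k j))) l (𝓝 (outer (stdVec n j))) := by
  set i₀ : Fin d := ⟨0, by omega⟩ with hi₀
  obtain ⟨τ, hτ⟩ := exists_perm_tendsto_factor hr (i₀ := i₀) (i₁ := ⟨1, by omega⟩)
    (i₂ := ⟨2, by omega⟩) (by simp [hi₀]) (by simp [hi₀]) (by simp) hu
  refine ⟨τ, fun j => tendsto_pi_nhds.mpr fun x => ?_⟩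
  -- `P` has the normalised vectors of the factor `i₀` as columns, and `W` inverts its top block.
  set P : ι → Matrix (Fin r) (Fin r) ℝ := fun k => Matrix.of fun a j' =>
    u k (τ k j') i₀ (diagIdx hr a i₀) / u k (τ k j') i₀ (diagIdx hr j' i₀) with hP
  have hPlim : Tendsto P l (𝓝 1) := by
    rw [tendsto_matrix_iff]
    intro a j'
    have : Tendsto (fun k => P k a j') l (𝓝 _) := (hτ j').2 (diagIdx hr a i₀)
    simpa [diagIdx_inj, Matrix.one_apply] using this
  have hW := tendsto_matrix_inv hPlim
  have hdet : ∀ᶠ k in l, (P k).det ≠ 0 := by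
    have := ((continuous_id (X := Matrix (Fin r) (Fin r) ℝ)).matrix_det.tendsto 1).comp hPlim
    rw [id, Matrix.det_one] at this
    exact this.eventually_ne one_ne_zero
  have hne : ∀ᶠ k in l, ∀ j', u k (τ k j') i₀ (diagIdx hr j' i₀) ≠ 0 :=
    eventually_all.mpr fun j' => (hτ j').1
  have hlim := ((hτ j).2 (x i₀)).mul (tendsto_finsetSum Finset.univ fun a (_ : a ∈ Finset.univ) =>
    (tendsto_matrix_iff.mp hW j a).mul
      (tendsto_pi_nhds.mp hu (update x i₀ (diagIdx hr a i₀))))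
  have hval : (if x i₀ = diagIdx hr j i₀ then (1 : ℝ) else 0) *
      ∑ a, (1 : Matrix (Fin r) (Fin r) ℝ) j a * baseTensor n r (update x i₀ (diagIdx hr a i₀)) =
        outer (stdVec n j) x := by
    rw [outer_stdVec_apply hr]
    simp only [Matrix.one_apply, ite_mul, one_mul, zero_mul, Finset.sum_ite_eq,
      Finset.mem_univ, if_true]
    by_cases hx : x i₀ = diagIdx hr j i₀
    · rw [if_pos hx, ← hx, update_eq_self, baseTensor_eq, Finset.sum_apply,
        Finset.sum_eq_single j]
      · rw [outer_stdVec_apply hr]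
      · intro j' _ hj'
        rw [outer_stdVec_apply hr, if_neg]
        intro h
        rw [h, diagIdx_inj] at hx
        exact hj' hx
      · simp
    · rw [if_neg hx, if_neg fun h => hx (congrFun h i₀)]
  rw [hval] at hlim
  refine hlim.congr' ?_
  filter_upwards [hdet, hne] with k hk1 hk2
  have hWP := Matrix.nonsing_inv_mul _ hk1.isUnit
  -- Applying row `j` of `W` in the factor `i₀` isolates the summand with index `τ k j`.
  have hiso : ∑ a, (P k)⁻¹ j a * (∑ j', outer (u k j')) (update x i₀ (diagIdx hr a i₀)) =
      u k (τ k j) i₀ (diagIdx hr j i₀) * ∏ i ∈ Finset.univ \ {i₀}, u k (τ k j) i (x i) := by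
    have h1 : ∀ a, (∑ j', outer (u k j')) (update x i₀ (diagIdx hr a i₀)) =
        ∑ j', P k a j' * (u k (τ k j') i₀ (diagIdx hr j' i₀) *
          ∏ i ∈ Finset.univ \ {i₀}, u k (τ k j') i (x i)) := by
      intro a
      rw [Finset.sum_apply, ← Equiv.sum_comp (τ k)]
      refine Finset.sum_congr rfl fun j' _ => ?_
      have h2 : P k a j' * u k (τ k j') i₀ (diagIdx hr j' i₀) =
          u k (τ k j') i₀ (diagIdx hr a i₀) := div_mul_cancel₀ _ (hk2 j')
      rw [outer_update, ← mul_assoc, h2]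
    simp only [h1, Finset.mul_sum, ← mul_assoc]
    rw [Finset.sum_comm]
    simp only [← Finset.sum_mul, ← Matrix.mul_apply, hWP, Matrix.one_apply]
    simp
  rw [hiso, ← mul_assoc, div_mul_cancel₀ _ (hk2 j), ← outer_update, update_eq_self]

/-- **Uniqueness of the CP decomposition** of the base tensor. -/
theorem exists_perm_outer_eq (hd : 3 ≤ d) (hr : ∀ i, r ≤ n i) {u : Fin r → ∀ i, Fin (n i) → ℝ}
    (hu : ∑ j, outer (u j) = baseTensor n r) :
    ∃ τ : Equiv.Perm (Fin r), ∀ j, outer (u (τ j)) = outer (stdVec n j) := by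
  obtain ⟨τ, hτ⟩ := exists_perm_tendsto_outer (l := pure ()) (u := fun _ : Unit => u) hd hr
    (by rw [hu]; exact tendsto_const_nhds)
  exact ⟨τ (), fun j => tendsto_nhds_unique (tendsto_pure_nhds _ ()) (hτ j)⟩

end Decomposition

/-! ### The stabilizer of the base tensor -/

section Stabilizer

variable {d : ℕ} {n : Fin d → ℕ} {r : ℕ}

theorem mem_H_iff_sum (hr : ∀ i, r ≤ n i) (h : G n) :
    h ∈ H n r ↔ ∑ j, outer (cols hr (comp h) j) = baseTensor n r := by
  rw [MulAction.mem_stabilizer_iff, smul_baseTensor hr]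

theorem outer_smul (c : Fin d → ℝ) (v : ∀ i, Fin (n i) → ℝ) :
    outer (fun i => c i • v i) = (∏ i, c i) • outer v := by
  funext k
  simp only [outer, Pi.smul_apply, smul_eq_mul, Finset.prod_mul_distrib]

/-- A rank-one tensor determines its vectors up to scalars, here for a tensor product of standard
basis vectors. -/
theorem eq_smul_stdVec_of_outer_eq (hr : ∀ i, r ≤ n i) {v : ∀ i, Fin (n i) → ℝ} {j : Fin r}
    (hv : outer v = outer (stdVec n j)) :
    (∏ i, v i (diagIdx hr j i) = 1) ∧
      ∀ i, v i = v i (diagIdx hr j i) • stdVec n j i := by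
  have h1 : ∏ i, v i (diagIdx hr j i) = 1 := by
    have := congrFun hv (diagIdx hr j)
    rwa [outer_stdVec_apply hr, if_pos rfl] at this
  refine ⟨h1, fun i => funext fun a => ?_⟩
  rw [Pi.smul_apply, smul_eq_mul, stdVec_apply hr]
  split_ifs with ha
  · rw [ha, mul_one]
  · have h2 := congrFun hv (update (diagIdx hr j) i a)
    rw [outer_stdVec_apply hr, if_neg fun h => ha (by simpa using congrFun h i), outer_update] at h2
    rw [mul_zero]
    refine (mul_eq_zero.mp h2).resolve_right (Finset.prod_ne_zero_iff.mpr fun i' _ => ?_)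
    exact Finset.prod_ne_zero_iff.mp (h1 ▸ one_ne_zero) i' (Finset.mem_univ i')

/-- The elements of the stabilizer permute the lines spanned by the first `r` standard basis
vectors, in the same way in every factor. -/
theorem mem_H_iff_cols (hd : 3 ≤ d) (hr : ∀ i, r ≤ n i) (h : G n) :
    h ∈ H n r ↔ ∃ (Q : Equiv.Perm (Fin r)) (D : Fin d → Fin r → ℝˣ), (∀ j, ∏ i, D i j = 1) ∧
      ∀ j i, cols hr (comp h) (Q j) i = (D i j : ℝ) • stdVec n j i := by
  rw [mem_H_iff_sum hr]
  constructor
  · intro hh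
    obtain ⟨Q, hQ⟩ := exists_perm_outer_eq hd hr hh
    have hQ' := fun j => eq_smul_stdVec_of_outer_eq hr (hQ j)
    have hne : ∀ i j, cols hr (comp h) (Q j) i (diagIdx hr j i) ≠ 0 := fun i j =>
      Finset.prod_ne_zero_iff.mp ((hQ' j).1 ▸ one_ne_zero) i (Finset.mem_univ i)
    refine ⟨Q, fun i j => Units.mk0 _ (hne i j), fun j => ?_, fun j i => (hQ' j).2 i⟩
    ext
    rw [Units.coe_prod]
    exact (hQ' j).1
  · rintro ⟨Q, D, hD, hcol⟩
    rw [← Equiv.sum_comp Q, baseTensor_eq]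
    refine Finset.sum_congr rfl fun j _ => ?_
    have h1 : cols hr (comp h) (Q j) = fun i => (D i j : ℝ) • stdVec n j i := funext (hcol j)
    have h2 : ∏ i, (D i j : ℝ) = 1 := by rw [← Units.coe_prod, hD, Units.val_one]
    rw [h1, outer_smul (fun i => (D i j : ℝ)), h2, one_smul]

/-- Membership in the block set only constrains the first `r` columns: the invertibility of the
lower right blocks follows from that of `h`. -/
theorem mem_blockSet_iff_cols (hr : ∀ i, r ≤ n i) (h : G n) :
    h ∈ blockSet hr ↔ ∃ (Q : Equiv.Perm (Fin r)) (D : Fin d → Fin r → ℝˣ), (∀ j, ∏ i, D i j = 1) ∧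
      ∀ j i, cols hr (comp h) (Q j) i = (D i j : ℝ) • stdVec n j i := by
  let e : ∀ i, Fin r ⊕ Fin (n i - r) ≃ Fin (n i) := fun i =>
    finSumFinEquiv.trans (finCongr (Nat.add_sub_of_le (hr i)))
  have hel : ∀ i j, e i (Sum.inl j) = diagIdx hr j i := fun i j => by ext; simp [e, diagIdx]
  have her : ∀ i b j, e i (Sum.inr b) ≠ diagIdx hr j i := fun i b j hb => by
    rw [← hel] at hb
    simpa using (e i).injective hb
  have hperm : ∀ (Q : Equiv.Perm (Fin r)) (D : Fin d → Fin r → ℝˣ) i a j,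
      (Matrix.diagonal (fun j => (D i j : ℝ)) * Q.permMatrix ℝ) a (Q j) =
        if a = j then (D i j : ℝ) else 0 := by
    intro Q D i a j
    rw [Matrix.diagonal_mul, Equiv.Perm.permMatrix, PEquiv.toMatrix_apply, Equiv.toPEquiv_apply]
    by_cases haj : a = j
    · simp [haj]
    · simp [haj]
  constructor
  · rintro ⟨Q, D, M, A, hD, hcomp⟩
    refine ⟨Q, D, hD, fun j i => funext fun a => ?_⟩
    rw [cols, hcomp i, ← hel, Pi.smul_apply, smul_eq_mul, stdVec_apply hr]
    change Matrix.fromBlocks _ _ _ _ ((e i).symm a) ((e i).symm (e i (Sum.inl (Q j)))) = _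
    rw [Equiv.symm_apply_apply]
    obtain ⟨b, rfl⟩ := (e i).surjective a
    rw [Equiv.symm_apply_apply]
    rcases b with b | b
    · rw [Matrix.fromBlocks_apply₁₁, hperm, hel]
      simp [diagIdx_inj]
    · rw [Matrix.fromBlocks_apply₂₁, if_neg (her i b j)]
      simp
  · rintro ⟨Q, D, hD, hcol⟩
    set N : ∀ i, Matrix (Fin r ⊕ Fin (n i - r)) (Fin r ⊕ Fin (n i - r)) ℝ := fun i =>
      (comp h i).submatrix (e i) (e i) with hN
    have hcol' : ∀ i a j, comp h i a (diagIdx hr (Q j) i) =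
        if a = diagIdx hr j i then (D i j : ℝ) else 0 := fun i a j => by
      have := congrFun (hcol j i) a
      rw [Pi.smul_apply, smul_eq_mul, stdVec_apply hr, mul_ite, mul_one, mul_zero] at this
      exact this
    have h11 : ∀ i, (N i).toBlocks₁₁ =
        Matrix.diagonal (fun j => (D i j : ℝ)) * Q.permMatrix ℝ := fun i => by
      ext a b
      obtain ⟨j, rfl⟩ := Q.surjective b
      rw [hperm]
      change comp h i (e i (Sum.inl a)) (e i (Sum.inl (Q j))) = _
      rw [hel, hel, hcol']
      simp [diagIdx_inj]
    have h21 : ∀ i, (N i).toBlocks₂₁ = 0 := fun i => by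
      ext a b
      obtain ⟨j, rfl⟩ := Q.surjective b
      change comp h i (e i (Sum.inr a)) (e i (Sum.inl (Q j))) = _
      rw [hel, hcol', if_neg (her i a j)]
      rfl
    have hNblocks : ∀ i, N i = Matrix.fromBlocks
        (Matrix.diagonal (fun j => (D i j : ℝ)) * Q.permMatrix ℝ) (N i).toBlocks₁₂ 0
        (N i).toBlocks₂₂ := fun i => by
      conv_lhs => rw [← Matrix.fromBlocks_toBlocks (N i), h11, h21]
    have hdet : ∀ i, (N i).toBlocks₂₂.det ≠ 0 := fun i => by
      have h1 : IsUnit (comp h i) := ⟨equivProdGL n h i, rfl⟩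
      have h2 : (N i).det ≠ 0 := by
        rw [hN, Matrix.det_submatrix_equiv_self]
        exact ((Matrix.isUnit_iff_isUnit_det _).mp h1).ne_zero
      rw [hNblocks i, Matrix.det_fromBlocks_zero₂₁] at h2
      exact right_ne_zero_of_mul h2
    refine ⟨Q, D, fun i => (N i).toBlocks₁₂,
      fun i => Matrix.GeneralLinearGroup.mkOfDetNeZero _ (hdet i), hD, fun i => ?_⟩
    change comp h i = Matrix.reindex (e i) (e i) (Matrix.fromBlocks _ _ 0 (N i).toBlocks₂₂)
    rw [← hNblocks i]
    ext a b
    simp [hN]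

theorem coe_H_eq_blockSet (hd : 3 ≤ d) (hr : ∀ i, r ≤ n i) :
    (H n r : Set (G n)) = blockSet hr := by
  ext h
  rw [SetLike.mem_coe, mem_H_iff_cols hd hr, mem_blockSet_iff_cols]

end Stabilizer

/-! ### Smooth maps to and from the group -/

section MatAlg

variable {d : ℕ} {n : Fin d → ℕ}

/-- Families of matrices as plain families of entries. -/
def matAlgEquiv (n : Fin d → ℕ) : MatAlg n ≃L[ℝ] (∀ i, Fin (n i) → Fin (n i) → ℝ) :=
  LinearEquiv.toContinuousLinearEquiv
    { toFun := fun X i a b => X i a b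
      invFun := fun X i => Matrix.of (X i)
      map_add' := fun _ _ => rfl
      map_smul' := fun _ _ => rfl
      left_inv := fun _ => rfl
      right_inv := fun _ => rfl }

theorem contDiff_entry {k : ℕ∞ω} (i : Fin d) (a b : Fin (n i)) :
    ContDiff ℝ k fun X : MatAlg n => X i a b :=
  contDiff_pi.mp (contDiff_pi.mp (contDiff_pi.mp (matAlgEquiv n).contDiff i) a) b

theorem contDiffOn_matAlg {k : ℕ∞ω} {F : Type*} [NormedAddCommGroup F] [NormedSpace ℝ F]
    {f : F → MatAlg n} {s : Set F} (h : ∀ i a b, ContDiffOn ℝ k (fun y => f y i a b) s) :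
    ContDiffOn ℝ k f s :=
  (matAlgEquiv n).comp_contDiffOn_iff.mp
    (contDiffOn_pi.mpr fun i => contDiffOn_pi.mpr fun a => contDiffOn_pi.mpr fun b => h i a b)

theorem tendsto_matAlg {ι : Type*} {l : Filter ι} {f : ι → MatAlg n} {X : MatAlg n}
    (h : ∀ i a b, Tendsto (fun y => f y i a b) l (𝓝 (X i a b))) : Tendsto f l (𝓝 X) := by
  have h1 : Tendsto (fun y => matAlgEquiv n (f y)) l (𝓝 (matAlgEquiv n X)) :=
    tendsto_pi_nhds.mpr fun i => tendsto_pi_nhds.mpr fun a => tendsto_pi_nhds.mpr fun b => h i a b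
  have h2 := ((matAlgEquiv n).symm.continuous.tendsto _).comp h1
  rw [ContinuousLinearEquiv.symm_apply_apply] at h2
  exact h2.congr fun y => (matAlgEquiv n).symm_apply_apply (f y)

/-- The element of `G` with the given family of matrices, if these are invertible, and `1`
otherwise. -/
def unitOf (X : MatAlg n) : G n := open Classical in if h : IsUnit X then h.unit else 1

theorem val_unitOf {X : MatAlg n} (h : IsUnit X) : (unitOf X : MatAlg n) = X := by
  rw [unitOf, dif_pos h, IsUnit.unit_spec]

theorem unitOf_val (g : G n) : unitOf (g : MatAlg n) = g := Units.ext (val_unitOf g.isUnit)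

theorem contMDiffOn_unitOf {k : ℕ∞ω} :
    ContMDiffOn 𝓘(ℝ, MatAlg n) (modelG n) k unitOf (range ((↑) : G n → MatAlg n)) := by
  have h := contMDiffOn_isOpenEmbedding_symm (I := 𝓘(ℝ, MatAlg n)) (n := k)
    (Units.isOpenEmbedding_val (R := MatAlg n))
  refine h.congr ?_
  rintro _ ⟨g, rfl⟩
  rw [unitOf_val, IsOpenEmbedding.toOpenPartialHomeomorph_left_inv]

theorem tendsto_unitOf {ι : Type*} {l : Filter ι} {f : ι → MatAlg n} (h : Tendsto f l (𝓝 1)) :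
    Tendsto (fun y => unitOf (f y)) l (𝓝 1) := by
  rw [(Units.isOpenEmbedding_val (R := MatAlg n)).isInducing.tendsto_nhds_iff]
  refine h.congr' ?_
  filter_upwards [h.eventually (Units.isOpen.mem_nhds isUnit_one)] with y hy
  exact (val_unitOf hy).symm

end MatAlg

/-! ### Normal forms modulo the stabilizer -/

section NormalForms

variable {d : ℕ} {n : Fin d → ℕ} {r : ℕ}

theorem smul_outer_stdVec (hr : ∀ i, r ≤ n i) (g : G n) (j : Fin r) :
    g • outer (stdVec n j) = outer (cols hr (comp g) j) := by
  rw [smul_outer, mulVec_stdVec hr]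

/-- Two elements of `G` that transform the base tensor in the same way have the same rank-one
tensors of columns, up to order. -/
theorem exists_perm_outer_cols_eq (hd : 3 ≤ d) (hr : ∀ i, r ≤ n i) {g g' : G n}
    (h : g • baseTensor n r = g' • baseTensor n r) :
    ∃ τ : Equiv.Perm (Fin r),
      ∀ j, outer (cols hr (comp g') (τ j)) = outer (cols hr (comp g) j) := by
  have hmem : ∑ j, outer (cols hr (comp (g⁻¹ * g')) j) = baseTensor n r := by
    rw [← smul_baseTensor hr, mul_smul, ← h, inv_smul_smul]
  obtain ⟨τ, hτ⟩ := exists_perm_outer_eq hd hr hmem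
  refine ⟨τ, fun j => ?_⟩
  rw [← smul_outer_stdVec, ← smul_outer_stdVec, ← hτ j, ← smul_outer_stdVec, smul_smul,
    mul_inv_cancel_left]

/-- The normal form attached to a family of rank-one tensors `x j`, close to `e_1^j ⊗ ⋯ ⊗ e_d^j`:
the family of matrices whose `j`-th columns, for `j < r`, have tensor product `x j` and are scaled
so that, in all factors except `i₀`, the `j`-th entry of the `j`-th column is `1`. The other
columns are those of the identity. -/
def normalForm (hr : ∀ i, r ≤ n i) (i₀ : Fin d) (x : Fin r → Tensor n) : MatAlg n :=
  fun i => Matrix.of fun a b => if h : (b : ℕ) < r then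
    x ⟨b, h⟩ (update (diagIdx hr ⟨b, h⟩) i a) /
      (if i = i₀ then 1 else x ⟨b, h⟩ (diagIdx hr ⟨b, h⟩)) else if a = b then 1 else 0

theorem cols_normalForm (hr : ∀ i, r ≤ n i) (i₀ : Fin d) (x : Fin r → Tensor n) (j : Fin r)
    (i : Fin d) (a : Fin (n i)) : cols hr (normalForm hr i₀ x) j i a =
      x j (update (diagIdx hr j) i a) / (if i = i₀ then 1 else x j (diagIdx hr j)) :=
  dif_pos j.2

theorem normalForm_apply_of_le (hr : ∀ i, r ≤ n i) (i₀ : Fin d) (x : Fin r → Tensor n)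
    {i : Fin d} {a b : Fin (n i)} (hb : r ≤ (b : ℕ)) :
    normalForm hr i₀ x i a b = if a = b then 1 else 0 :=
  dif_neg (not_lt.mpr hb)

/-- Comparison of families of matrices on the first `r` columns and on the others. -/
theorem matAlg_ext (hr : ∀ i, r ≤ n i) {X Y : MatAlg n}
    (h1 : ∀ j i a, cols hr X j i a = cols hr Y j i a)
    (h2 : ∀ i (a b : Fin (n i)), r ≤ (b : ℕ) → X i a b = Y i a b) : X = Y := by
  refine (matAlgEquiv n).injective (funext fun i => funext fun a => funext fun b => ?_)
  rcases lt_or_ge (b : ℕ) r with hb | hb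
  · exact h1 ⟨b, hb⟩ i a
  · exact h2 i a b hb

/-- The normal form of the rank-one tensors `u j` has columns with tensor products `u j`. -/
theorem outer_cols_normalForm (hr : ∀ i, r ≤ n i) (i₀ : Fin d) {u : Fin r → ∀ i, Fin (n i) → ℝ}
    {j : Fin r} (hj : outer (u j) (diagIdx hr j) ≠ 0) :
    outer (cols hr (normalForm hr i₀ fun j => outer (u j)) j) = outer (u j) := by
  set P := outer (u j) (diagIdx hr j) with hP
  have hne : ∀ i, u j i (diagIdx hr j i) ≠ 0 := fun i =>
    Finset.prod_ne_zero_iff.mp hj i (Finset.mem_univ i)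
  have hupd : ∀ i a, outer (u j) (update (diagIdx hr j) i a) =
      P * (u j i (diagIdx hr j i))⁻¹ * u j i a := by
    intro i a
    have h1 : P = u j i (diagIdx hr j i) *
        ∏ i' ∈ Finset.univ \ {i}, u j i' (diagIdx hr j i') := by
      rw [← outer_update, update_eq_self]
    rw [outer_update, h1]
    field_simp [hne i]
  have hcol : cols hr (normalForm hr i₀ fun j => outer (u j)) j = fun i =>
      ((u j i (diagIdx hr j i))⁻¹ * if i = i₀ then P else 1) • u j i := by
    funext i a
    rw [cols_normalForm, hupd, ← hP, Pi.smul_apply, smul_eq_mul]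
    split_ifs
    · ring
    · field_simp
  rw [hcol, outer_smul (fun i => (u j i (diagIdx hr j i))⁻¹ * if i = i₀ then P else 1),
    Finset.prod_mul_distrib, Finset.prod_inv_distrib]
  have h2 : ∏ i, u j i (diagIdx hr j i) = P := rfl
  rw [h2, Finset.prod_ite_eq' Finset.univ i₀, if_pos (Finset.mem_univ _), inv_mul_cancel₀ hj,
    one_smul]

/-- If the normal form of the summands of `g • baseTensor n r` is invertible, then it transforms the
base tensor in the same way as `g`. -/
theorem unitOf_normalForm_smul (hr : ∀ i, r ≤ n i) (i₀ : Fin d) {u : Fin r → ∀ i, Fin (n i) → ℝ}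
    (hu : ∀ j, outer (u j) (diagIdx hr j) ≠ 0)
    (hunit : IsUnit (normalForm hr i₀ fun j => outer (u j))) :
    unitOf (normalForm hr i₀ fun j => outer (u j)) • baseTensor n r = ∑ j, outer (u j) := by
  rw [smul_baseTensor hr]
  refine Finset.sum_congr rfl fun j _ => ?_
  have : comp (unitOf (normalForm hr i₀ fun j => outer (u j))) =
      normalForm hr i₀ fun j => outer (u j) := val_unitOf hunit
  rw [this, outer_cols_normalForm hr i₀ (hu j)]

/-- The direction of the affine space of normal forms. -/
def sliceSpace (hr : ∀ i, r ≤ n i) (i₀ : Fin d) : Submodule ℝ (MatAlg n) where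
  carrier := {X | (∀ i (a b : Fin (n i)), r ≤ (b : ℕ) → X i a b = 0) ∧
    ∀ j i, i ≠ i₀ → cols hr X j i (diagIdx hr j i) = 0}
  add_mem' {X Y} hX hY := ⟨fun i a b hb => by
      change X i a b + Y i a b = 0
      rw [hX.1 i a b hb, hY.1 i a b hb, add_zero], fun j i hi => by
      change cols hr X j i _ + cols hr Y j i _ = 0
      rw [hX.2 j i hi, hY.2 j i hi, add_zero]⟩
  zero_mem' := ⟨fun _ _ _ _ => rfl, fun _ _ _ => rfl⟩
  smul_mem' c X hX := ⟨fun i a b hb => by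
      change c * X i a b = 0
      rw [hX.1 i a b hb, mul_zero], fun j i hi => by
      change c * cols hr X j i _ = 0
      rw [hX.2 j i hi, mul_zero]⟩

theorem cols_one (hr : ∀ i, r ≤ n i) (j : Fin r) :
    cols hr (1 : MatAlg n) j = stdVec n j := by
  funext i a
  rw [stdVec_apply hr]
  exact Matrix.one_apply

/-- Normal forms lie in the affine space `1 + sliceSpace hr i₀`. -/
theorem normalForm_sub_one_mem (hr : ∀ i, r ≤ n i) (i₀ : Fin d) {x : Fin r → Tensor n}
    (hx : ∀ j, x j (diagIdx hr j) ≠ 0) : normalForm hr i₀ x - 1 ∈ sliceSpace hr i₀ := by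
  constructor
  · intro i a b hb
    change normalForm hr i₀ x i a b - (1 : Matrix (Fin (n i)) (Fin (n i)) ℝ) a b = 0
    rw [normalForm_apply_of_le hr i₀ x hb, Matrix.one_apply, sub_self]
  · intro j i hi
    change cols hr (normalForm hr i₀ x) j i (diagIdx hr j i) -
      cols hr (1 : MatAlg n) j i (diagIdx hr j i) = 0
    rw [cols_normalForm, if_neg hi, update_eq_self, div_self (hx j), cols_one, stdVec_apply hr,
      if_pos rfl, sub_self]

/-- Families of matrices in normal form are their own normal form. -/
theorem normalForm_outer_cols (hr : ∀ i, r ≤ n i) (i₀ : Fin d) {X : MatAlg n}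
    (hX : X - 1 ∈ sliceSpace hr i₀) (hX₀ : ∀ j, cols hr X j i₀ (diagIdx hr j i₀) ≠ 0) :
    normalForm hr i₀ (fun j => outer (cols hr X j)) = X := by
  have h1 : ∀ j i, i ≠ i₀ → cols hr X j i (diagIdx hr j i) = 1 := by
    intro j i hi
    have h2 : cols hr X j i (diagIdx hr j i) - cols hr (1 : MatAlg n) j i (diagIdx hr j i) = 0 :=
      hX.2 j i hi
    rwa [cols_one, stdVec_apply hr, if_pos rfl, sub_eq_zero] at h2
  refine matAlg_ext hr (fun j i a => ?_) fun i a b hb => ?_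
  · rw [cols_normalForm, outer_update]
    by_cases hi : i = i₀
    · subst hi
      rw [if_pos rfl, div_one, Finset.prod_eq_one, mul_one]
      intro i' hi'
      exact h1 j i' (by simpa using hi')
    · have h3 : outer (cols hr X j) (diagIdx hr j) = 1 *
          ∏ i' ∈ Finset.univ \ {i}, cols hr X j i' (diagIdx hr j i') := by
        rw [← h1 j i hi, ← outer_update, update_eq_self]
      rw [if_neg hi, h3, one_mul]
      refine mul_div_cancel_right₀ _ (Finset.prod_ne_zero_iff.mpr fun i' _ => ?_)
      by_cases hi' : i' = i₀
      · rw [hi']; exact hX₀ j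
      · rw [h1 j i' hi']; exact one_ne_zero
  · rw [normalForm_apply_of_le hr i₀ _ hb]
    have h2 : X i a b - (1 : Matrix (Fin (n i)) (Fin (n i)) ℝ) a b = 0 := hX.1 i a b hb
    rw [Matrix.one_apply, sub_eq_zero] at h2
    exact h2.symm

theorem normalForm_stdVec (hr : ∀ i, r ≤ n i) (i₀ : Fin d) :
    normalForm hr i₀ (fun j => outer (stdVec n j)) = 1 := by
  have h := normalForm_outer_cols hr i₀ (X := 1)
    (by rw [sub_self]; exact (sliceSpace hr i₀).zero_mem) fun j => by
      rw [cols_one, stdVec_apply hr, if_pos rfl]; exact one_ne_zero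
  simpa only [cols_one] using h

theorem contDiff_outer_cols {k : ℕ∞ω} (hr : ∀ i, r ≤ n i) (j : Fin r) :
    ContDiff ℝ k fun X : MatAlg n => outer (cols hr X j) :=
  contDiff_pi.mpr fun _ => contDiff_prod fun i _ => contDiff_entry i _ _

theorem contDiffOn_normalForm {k : ℕ∞ω} (hr : ∀ i, r ≤ n i) (i₀ : Fin d) :
    ContDiffOn ℝ k (fun X : MatAlg n => normalForm hr i₀ fun j => outer (cols hr X j))
      {X | ∀ j, outer (cols hr X j) (diagIdx hr j) ≠ 0} := by
  refine contDiffOn_matAlg fun i a b => ?_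
  have h1 : ∀ j x, ContDiff ℝ k fun X : MatAlg n => outer (cols hr X j) x := fun j x =>
    contDiff_pi.mp (contDiff_outer_cols hr j) x
  by_cases hb : (b : ℕ) < r
  · have h2 : (fun X : MatAlg n => normalForm hr i₀ (fun j => outer (cols hr X j)) i a b) =
        fun X => outer (cols hr X ⟨b, hb⟩) (update (diagIdx hr ⟨b, hb⟩) i a) /
          (if i = i₀ then 1 else outer (cols hr X ⟨b, hb⟩) (diagIdx hr ⟨b, hb⟩)) :=
      funext fun X => dif_pos hb
    rw [h2]
    by_cases hi : i = i₀
    · simp only [if_pos hi, div_one]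
      exact (h1 _ _).contDiffOn
    · simp only [if_neg hi]
      exact (h1 _ _).contDiffOn.div (h1 _ _).contDiffOn fun X hX => hX _
  · have h2 : (fun X : MatAlg n => normalForm hr i₀ (fun j => outer (cols hr X j)) i a b) =
        fun _ => if a = b then 1 else 0 := funext fun X => dif_neg hb
    rw [h2]
    exact contDiffOn_const

theorem tendsto_normalForm {ι : Type*} {l : Filter ι} (hr : ∀ i, r ≤ n i) (i₀ : Fin d)
    {x : ι → Fin r → Tensor n} (hx : ∀ j, Tendsto (fun k => x k j) l (𝓝 (outer (stdVec n j)))) :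
    Tendsto (fun k => normalForm hr i₀ (x k)) l (𝓝 1) := by
  rw [← normalForm_stdVec hr i₀]
  have hx' : ∀ j y, Tendsto (fun k => x k j y) l (𝓝 (outer (stdVec n j) y)) := fun j =>
    tendsto_pi_nhds.mp (hx j)
  refine tendsto_matAlg fun i a b => ?_
  by_cases hb : (b : ℕ) < r
  · have h2 : ∀ x : Fin r → Tensor n, normalForm hr i₀ x i a b =
        x ⟨b, hb⟩ (update (diagIdx hr ⟨b, hb⟩) i a) /
          (if i = i₀ then 1 else x ⟨b, hb⟩ (diagIdx hr ⟨b, hb⟩)) := fun x => dif_pos hb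
    simp only [h2]
    by_cases hi : i = i₀
    · simp only [if_pos hi, div_one]
      exact hx' _ _
    · simp only [if_neg hi]
      refine (hx' _ _).div (hx' _ _) ?_
      rw [outer_stdVec_apply hr, if_pos rfl]
      exact one_ne_zero
  · have h2 : ∀ x : Fin r → Tensor n, normalForm hr i₀ x i a b = if a = b then 1 else 0 :=
      fun x => dif_neg hb
    simp only [h2]
    exact tendsto_const_nhds

end NormalForms

/-! ### The slice of the stabilizer -/

section StandardSlice

variable {d : ℕ} {n : Fin d → ℕ} {r : ℕ}

/-- The families of matrices whose columns have an invertible normal form, and whose `j`-th columns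
have, for all `j < r`, no zero diagonal entry and, in the factor `i₀`, a strictly dominant diagonal
entry. Dominance makes the order of the columns recoverable from the unordered family of their
tensor products. -/
def sliceDomain (hr : ∀ i, r ≤ n i) (i₀ : Fin d) : Set (MatAlg n) :=
  {X | ((∀ j, outer (cols hr X j) (diagIdx hr j) ≠ 0) ∧
      ∀ j a, a ≠ diagIdx hr j i₀ → |outer (cols hr X j) (update (diagIdx hr j) i₀ a)| <
        |outer (cols hr X j) (diagIdx hr j)|) ∧
    IsUnit (normalForm hr i₀ fun j => outer (cols hr X j))}

theorem isOpen_sliceDomain (hr : ∀ i, r ≤ n i) (i₀ : Fin d) : IsOpen (sliceDomain hr i₀) := by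
  have hc : ∀ j x, Continuous fun X : MatAlg n => outer (cols hr X j) x := fun j x =>
    (continuous_apply x).comp (contDiff_outer_cols (k := 0) hr j).continuous
  have h1 : IsOpen {X : MatAlg n | (∀ j, outer (cols hr X j) (diagIdx hr j) ≠ 0) ∧
      ∀ j a, a ≠ diagIdx hr j i₀ → |outer (cols hr X j) (update (diagIdx hr j) i₀ a)| <
        |outer (cols hr X j) (diagIdx hr j)|} := by
    simp only [ofPred_and, ofPred_forall]
    refine (isOpen_iInter_of_finite fun j => isOpen_ne_fun (hc _ _) continuous_const).inter
      (isOpen_iInter_of_finite fun j => isOpen_iInter_of_finite fun a =>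
        isOpen_iInter_of_finite fun _ => isOpen_lt (hc _ _).abs (hc _ _).abs)
  exact ((contDiffOn_normalForm (k := 0) hr i₀).continuousOn.mono
    fun X hX => hX.1).isOpen_inter_preimage h1 Units.isOpen

theorem one_mem_sliceDomain (hr : ∀ i, r ≤ n i) (i₀ : Fin d) : 1 ∈ sliceDomain hr i₀ := by
  simp only [sliceDomain, mem_ofPred_eq, cols_one, normalForm_stdVec, outer_stdVec_apply hr]
  refine ⟨⟨fun j => by simp, fun j a ha => ?_⟩, isUnit_one⟩
  rw [if_neg, if_pos trivial]
  · simp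
  · exact fun h => ha (by rw [← h, update_self])

theorem outer_cols_normalForm_cols (hr : ∀ i, r ≤ n i) {i₀ : Fin d} {X : MatAlg n}
    (hX : X ∈ sliceDomain hr i₀) (j : Fin r) :
    outer (cols hr (normalForm hr i₀ fun j => outer (cols hr X j)) j) = outer (cols hr X j) :=
  outer_cols_normalForm hr i₀ (hX.1.1 j)

theorem normalForm_mem_sliceDomain (hr : ∀ i, r ≤ n i) {i₀ : Fin d} {X : MatAlg n}
    (hX : X ∈ sliceDomain hr i₀) :
    (normalForm hr i₀ fun j => outer (cols hr X j)) ∈ sliceDomain hr i₀ := by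
  simpa only [sliceDomain, mem_ofPred_eq, outer_cols_normalForm_cols hr hX] using hX

/-- The index of a rank-one tensor of columns is determined by the position of its dominant entry in
the factor `i₀`. -/
theorem eq_of_outer_cols_eq (hr : ∀ i, r ≤ n i) {i₀ : Fin d} {X Y : MatAlg n}
    (hX : X ∈ sliceDomain hr i₀) (hY : Y ∈ sliceDomain hr i₀) {j s : Fin r}
    (h : outer (cols hr Y s) = outer (cols hr X j)) : s = j := by
  by_contra hne
  have key : ∀ (v : ∀ i, Fin (n i) → ℝ) (k l : Fin r), k ≠ l →
      (∀ a, a ≠ diagIdx hr k i₀ → |outer v (update (diagIdx hr k) i₀ a)| <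
        |outer v (diagIdx hr k)|) → |v i₀ (diagIdx hr l i₀)| < |v i₀ (diagIdx hr k i₀)| := by
    intro v k l hkl hv
    have h1 := hv (diagIdx hr l i₀) fun h => hkl ((diagIdx_inj hr).mp h).symm
    have h2 := outer_update v (diagIdx hr k) i₀ (diagIdx hr k i₀)
    rw [update_eq_self] at h2
    rw [h2, outer_update, abs_mul, abs_mul] at h1
    exact lt_of_mul_lt_mul_right h1 (abs_nonneg _)
  have h1 := key _ j s (Ne.symm hne) (hX.1.2 j)
  have h2 := key (cols hr X j) s j hne (by rw [← h]; exact hY.1.2 s)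
  exact lt_asymm h1 h2

/-- Elements of the slice domain in the same coset have the same rank-one tensors of columns, in the
same order. -/
theorem outer_cols_eq_of_mk_eq (hd : 3 ≤ d) (hr : ∀ i, r ≤ n i) {i₀ : Fin d} {g g' : G n}
    (hg : (g : MatAlg n) ∈ sliceDomain hr i₀) (hg' : (g' : MatAlg n) ∈ sliceDomain hr i₀)
    (h : (g : G n ⧸ H n r) = g') (j : Fin r) :
    outer (cols hr (g : MatAlg n) j) = outer (cols hr (g' : MatAlg n) j) := by
  have h1 : g • baseTensor n r = g' • baseTensor n r := by
    have := QuotientGroup.eq.mp h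
    rw [MulAction.mem_stabilizer_iff, mul_smul, inv_smul_eq_iff] at this
    exact this.symm
  obtain ⟨τ, hτ⟩ := exists_perm_outer_cols_eq hd hr h1
  have h2 := hτ j
  rw [eq_of_outer_cols_eq hr hg hg' h2] at h2
  exact h2.symm

/-- The normal form of the rank-one summands of `g • baseTensor n r`, in any order, represents the
coset of `g`. -/
theorem mk_unitOf_eq (hr : ∀ i, r ≤ n i) (i₀ : Fin d) {g : G n} (τ : Equiv.Perm (Fin r))
    (hu : ∀ j, outer (cols hr (comp g) (τ j)) (diagIdx hr j) ≠ 0)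
    (hunit : IsUnit (normalForm hr i₀ fun j => outer (cols hr (comp g) (τ j)))) :
    (unitOf (normalForm hr i₀ fun j => outer (cols hr (comp g) (τ j))) : G n ⧸ H n r) = g := by
  rw [QuotientGroup.eq, MulAction.mem_stabilizer_iff, mul_smul, inv_smul_eq_iff,
    unitOf_normalForm_smul hr i₀ (u := fun j => cols hr (comp g) (τ j)) hu hunit,
    smul_baseTensor hr]
  exact (Equiv.sum_comp τ fun j => outer (cols hr (comp g) j)).symm

theorem normalForm_eq_self (hr : ∀ i, r ≤ n i) {i₀ : Fin d} {X : MatAlg n}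
    (hX : X ∈ sliceDomain hr i₀) (hX' : X - 1 ∈ sliceSpace hr i₀) :
    normalForm hr i₀ (fun j => outer (cols hr X j)) = X :=
  normalForm_outer_cols hr i₀ hX' fun j =>
    Finset.prod_ne_zero_iff.mp (hX.1.1 j) i₀ (Finset.mem_univ _)

variable {S : Type*} [NormedAddCommGroup S] [NormedSpace ℝ S]

/-- The coordinates of elements of the slice domain, relative to a parametrisation `e` of the slice
space with left inverse `p`, are the parameters of normal forms in the slice domain. -/
theorem image_coord_eq (hr : ∀ i, r ≤ n i) (i₀ : Fin d) {e : S →L[ℝ] MatAlg n}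
    {p : MatAlg n →L[ℝ] S} (he : ∀ y, e y ∈ sliceSpace hr i₀) (hpe : ∀ y, p (e y) = y)
    (hep : ∀ X ∈ sliceSpace hr i₀, e (p X) = X) :
    (fun g : G n => p (normalForm hr i₀ (fun j => outer (cols hr (g : MatAlg n) j)) - 1)) ''
      ((↑) ⁻¹' sliceDomain hr i₀) =
    (fun y => 1 + e y) ⁻¹' (sliceDomain hr i₀ ∩ {X | IsUnit X}) := by
  ext y
  constructor
  · rintro ⟨g, hg, rfl⟩
    rw [mem_preimage, hep _ (normalForm_sub_one_mem hr i₀ hg.1.1), add_sub_cancel]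
    exact ⟨normalForm_mem_sliceDomain hr hg, hg.2⟩
  · rintro ⟨hy, hu⟩
    refine ⟨unitOf (1 + e y), ?_, ?_⟩
    · rw [mem_preimage, val_unitOf hu]; exact hy
    · beta_reduce
      rw [val_unitOf hu, normalForm_eq_self hr hy (by rw [add_sub_cancel_left]; exact he y),
        add_sub_cancel_left, hpe]

/-- The slice for the right action of the stabilizer of the base tensor in which the coset of an
element of the slice domain is represented by its normal form, and normal forms are parametrised by
`y ↦ 1 + e y`. -/
def standardSlice (hd : 3 ≤ d) (hr : ∀ i, r ≤ n i) (i₀ : Fin d) {e : S →L[ℝ] MatAlg n}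
    {p : MatAlg n →L[ℝ] S} (he : ∀ y, e y ∈ sliceSpace hr i₀) (hpe : ∀ y, p (e y) = y)
    (hep : ∀ X ∈ sliceSpace hr i₀, e (p X) = X) : Slice (modelG n) ∞ (H n r) S where
  nhd := (↑) ⁻¹' sliceDomain hr i₀
  coord g := p (normalForm hr i₀ (fun j => outer (cols hr (g : MatAlg n) j)) - 1)
  lift y := unitOf (1 + e y)
  isOpen_nhd := (isOpen_sliceDomain hr i₀).preimage Units.continuous_val
  one_mem := one_mem_sliceDomain hr i₀
  isOpen_image := by
    rw [image_coord_eq hr i₀ he hpe hep]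
    exact ((isOpen_sliceDomain hr i₀).inter Units.isOpen).preimage
      (continuous_const.add e.continuous)
  contMDiffOn_coord := by
    have h1 : ContDiffOn ℝ ∞ (fun X : MatAlg n =>
        p (normalForm hr i₀ (fun j => outer (cols hr X j)) - 1)) (sliceDomain hr i₀) :=
      p.contDiff.comp_contDiffOn (((contDiffOn_normalForm hr i₀).mono
        fun X hX => hX.1.1).sub contDiffOn_const)
    exact h1.contMDiffOn.comp Units.contMDiff_val.contMDiffOn fun g hg => hg
  contMDiffOn_lift := by
    rw [image_coord_eq hr i₀ he hpe hep]
    have h1 : ContDiff ℝ ∞ fun y => 1 + e y := contDiff_const.add e.contDiff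
    exact contMDiffOn_unitOf.comp h1.contMDiff.contMDiffOn fun y hy => ⟨hy.2.unit, rfl⟩
  coord_eq g hg g' hg' h := by
    rw [funext fun j => outer_cols_eq_of_mk_eq hd hr hg hg' h j]
  mk_lift g hg := by
    rw [hep _ (normalForm_sub_one_mem hr i₀ hg.1.1), add_sub_cancel]
    exact mk_unitOf_eq hr i₀ (Equiv.refl _) hg.1.1 hg.2

end StandardSlice

/-! ### The orbit map -/

section OrbitMap

variable {d : ℕ} {n : Fin d → ℕ} {r : ℕ}

theorem contDiff_sum_outer_cols {k : ℕ∞ω} (hr : ∀ i, r ≤ n i) :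
    ContDiff ℝ k fun X : MatAlg n => ∑ j : Fin r, outer (cols hr X j) :=
  ContDiff.sum fun j _ => contDiff_outer_cols hr j

theorem contMDiff_smul_baseTensor (hr : ∀ i, r ≤ n i) {k : ℕ∞ω} :
    ContMDiff (modelG n) 𝓘(ℝ, Tensor n) k fun g : G n => g • baseTensor n r := by
  simp only [smul_baseTensor hr]
  exact (contDiff_sum_outer_cols hr).contMDiff.comp Units.contMDiff_val

/-- The derivative at `1` of `X ↦ ∑ j, outer (cols hr X j)`, in the direction `Z`. -/
theorem fderiv_sum_outer_cols (hr : ∀ i, r ≤ n i) (Z : MatAlg n) (k : ∀ i, Fin (n i)) :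
    fderiv ℝ (fun X : MatAlg n => ∑ j : Fin r, outer (cols hr X j)) 1 Z k =
      ∑ j : Fin r, ∑ i,
        (∏ i' ∈ Finset.univ.erase i, stdVec n j i' (k i')) * cols hr Z j i (k i) := by
  have h1 : HasLineDerivAt ℝ (fun X : MatAlg n => ∑ j : Fin r, outer (cols hr X j))
      (fderiv ℝ (fun X : MatAlg n => ∑ j : Fin r, outer (cols hr X j)) 1 Z) 1 Z :=
    ((contDiff_sum_outer_cols (k := 1) hr).differentiable one_ne_zero
      1).hasFDerivAt.hasLineDerivAt Z
  have h2 := hasDerivAt_pi.mp h1 k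
  have h3 : HasDerivAt
      (fun t : ℝ => ∑ j : Fin r, ∏ i, (stdVec n j i (k i) + t * cols hr Z j i (k i)))
      (∑ j : Fin r, ∑ i, (∏ i' ∈ Finset.univ.erase i,
        (stdVec n j i' (k i') + 0 * cols hr Z j i' (k i'))) • cols hr Z j i (k i)) 0 := by
    refine HasDerivAt.fun_sum fun j _ => HasDerivAt.fun_finsetProd fun i _ => ?_
    simpa using ((hasDerivAt_id (0 : ℝ)).mul_const (cols hr Z j i (k i))).const_add
      (stdVec n j i (k i))
  have h4 : (fun t : ℝ => (∑ j : Fin r, outer (cols hr (1 + t • Z : MatAlg n) j)) k) =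
      fun t : ℝ => ∑ j : Fin r, ∏ i, (stdVec n j i (k i) + t * cols hr Z j i (k i)) := by
    funext t
    rw [Finset.sum_apply]
    refine Finset.sum_congr rfl fun j _ => Finset.prod_congr rfl fun i _ => ?_
    rw [← cols_one hr]
    rfl
  rw [← h4] at h3
  rw [h2.unique h3]
  simp

/-- The directions of the slice are transverse to the stabilizer: the derivative of the orbit map is
injective on them. -/
theorem eq_zero_of_fderiv_sum_outer_cols (hd : 3 ≤ d) (hr : ∀ i, r ≤ n i) {i₀ : Fin d}
    {Z : MatAlg n} (hZ : Z ∈ sliceSpace hr i₀)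
    (h : fderiv ℝ (fun X : MatAlg n => ∑ j : Fin r, outer (cols hr X j)) 1 Z = 0) : Z = 0 := by
  have hne : ∀ {j j' : Fin r} {i : Fin d}, j' ≠ j → stdVec n j' i (diagIdx hr j i) = 0 := by
    intro j j' i hj
    rw [stdVec_apply hr, if_neg]
    rw [diagIdx_inj]
    exact hj.symm
  -- This is the entry of the derivative at an index that differs from `(j, …, j)` in at most one
  -- place.
  have key : ∀ j i₁ a, (a ≠ diagIdx hr j i₁ ∨ i₁ = i₀) → cols hr Z j i₁ a = 0 := by
    intro j i₁ a ha
    have h1 := fderiv_sum_outer_cols hr Z (update (diagIdx hr j) i₁ a)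
    rw [h, Finset.sum_eq_single j, Finset.sum_eq_single i₁, Finset.prod_eq_one, one_mul,
      update_self] at h1
    · exact h1.symm
    · intro i' hi'
      rw [update_of_ne (Finset.ne_of_mem_erase hi'), stdVec_apply hr, if_pos rfl]
    · intro i _ hi
      by_cases ha' : a = diagIdx hr j i₁
      · rw [ha', update_eq_self, hZ.2 j i fun hi0 => hi ?_, mul_zero]
        rw [hi0, ha.resolve_left (not_not_intro ha')]
      · rw [Finset.prod_eq_zero (i := i₁), zero_mul]
        · exact Finset.mem_erase.mpr ⟨hi.symm, Finset.mem_univ _⟩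
        · rw [update_self, stdVec_apply hr, if_neg ha']
    · exact fun hi => absurd (Finset.mem_univ _) hi
    · intro j' _ hj'
      refine Finset.sum_eq_zero fun i _ => ?_
      -- As `d ≥ 3`, there is a factor other than `i` and `i₁`.
      obtain ⟨i', hi'⟩ : ∃ i', i' ∉ ({i, i₁} : Finset (Fin d)) := by
        by_contra! hall
        have h2 := Finset.card_le_card fun x (_ : x ∈ (Finset.univ : Finset (Fin d))) => hall x
        rw [Finset.card_univ, Fintype.card_fin] at h2
        exact absurd (h2.trans Finset.card_le_two) (by omega)
      rw [Finset.mem_insert, Finset.mem_singleton, not_or] at hi'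
      rw [Finset.prod_eq_zero (i := i'), zero_mul]
      · exact Finset.mem_erase.mpr ⟨hi'.1, Finset.mem_univ _⟩
      · rw [update_of_ne hi'.2, hne hj']
    · exact fun hj => absurd (Finset.mem_univ _) hj
  refine matAlg_ext hr (fun j i a => ?_) fun i a b hb => hZ.1 i a b hb
  change cols hr Z j i a = 0
  by_cases ha : a ≠ diagIdx hr j i ∨ i = i₀
  · exact key j i a ha
  · rw [not_or, not_not] at ha
    rw [ha.1]
    exact hZ.2 j i ha.2

/-- If `g • baseTensor n r` tends to the base tensor, then the coset of `g` tends to that of `1`: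
the rank-one summands converge, up to order, and with them their normal form. -/
theorem tendsto_mk_comap_smul_baseTensor (hd : 3 ≤ d) (hr : ∀ i, r ≤ n i) :
    Tendsto ((↑) : G n → G n ⧸ H n r) (comap (fun g : G n => g • baseTensor n r)
      (𝓝 (baseTensor n r))) (𝓝 ((1 : G n) : G n ⧸ H n r)) := by
  set l := comap (fun g : G n => g • baseTensor n r) (𝓝 (baseTensor n r))
  have i₀ : Fin d := ⟨0, by omega⟩
  have h1 : Tendsto (fun g : G n => ∑ j, outer (cols hr (comp g) j)) l (𝓝 (baseTensor n r)) := by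
    simp only [← smul_baseTensor hr]
    exact tendsto_comap
  obtain ⟨τ, hτ⟩ := exists_perm_tendsto_outer hd hr h1
  have h2 := tendsto_normalForm hr i₀ hτ
  refine ((QuotientGroup.continuous_mk.tendsto (1 : G n)).comp (tendsto_unitOf h2)).congr' ?_
  have h3 : ∀ᶠ g in l, ∀ j, outer (cols hr (comp g) (τ g j)) (diagIdx hr j) ≠ 0 := by
    refine eventually_all.mpr fun j => (tendsto_pi_nhds.mp (hτ j) (diagIdx hr j)).eventually_ne ?_
    rw [outer_stdVec_apply hr, if_pos rfl]
    exact one_ne_zero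
  filter_upwards [h3, h2.eventually (Units.isOpen.mem_nhds isUnit_one)] with g hg hu
  exact mk_unitOf_eq hr i₀ (τ g) hg hu

theorem isEmbedding_orbitMap (hd : 3 ≤ d) (hr : ∀ i, r ≤ n i) :
    IsEmbedding (MulAction.ofQuotientStabilizer (G n) (baseTensor n r)) :=
  isEmbedding_ofQuotientStabilizer (contMDiff_smul_baseTensor (k := 0) hr).continuous
    (tendsto_mk_comap_smul_baseTensor hd hr)

theorem range_orbitMap (hd : 2 ≤ d) (hr : ∀ i, r ≤ n i) :
    range (MulAction.ofQuotientStabilizer (G n) (baseTensor n r)) = SigmaSet n r := by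
  rw [SigmaSet_eq_orbit hd hr, MulAction.orbit, ← QuotientGroup.mk_surjective.range_comp]
  rfl

variable {S : Type*} [NormedAddCommGroup S] [NormedSpace ℝ S] [ChartedSpace S (G n ⧸ H n r)]

theorem contMDiff_orbitMap (hr : ∀ i, r ≤ n i) (h : HasSmoothSections (modelG n) ∞ (H n r) S) :
    ContMDiff 𝓘(ℝ, S) 𝓘(ℝ, Tensor n) ∞
      (MulAction.ofQuotientStabilizer (G n) (baseTensor n r)) :=
  h.contMDiff_iff_comp_mk.mpr (contMDiff_smul_baseTensor hr)

/-- The orbit map is an immersion: translated to the base point and restricted to the slice, its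
derivative is injective. -/
theorem mfderiv_orbitMap_injective [FiniteDimensional ℝ S] (hd : 3 ≤ d) (hr : ∀ i, r ≤ n i)
    {i₀ : Fin d} (h : HasSmoothSections (modelG n) ∞ (H n r) S) {e : S →L[ℝ] MatAlg n}
    (he : ∀ y, e y ∈ sliceSpace hr i₀) (he' : Injective e) (x : G n ⧸ H n r) :
    Injective (mfderiv 𝓘(ℝ, S) 𝓘(ℝ, Tensor n)
      (MulAction.ofQuotientStabilizer (G n) (baseTensor n r)) x) := by
  obtain ⟨g, rfl⟩ := QuotientGroup.mk_surjective x
  set φ := MulAction.ofQuotientStabilizer (G n) (baseTensor n r)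
  set j : S → G n ⧸ H n r := fun y => ((g * unitOf (1 + e y) : G n) : G n ⧸ H n r) with hj
  have hunit : ∀ᶠ y in 𝓝 (0 : S), IsUnit (1 + e y) := by
    have h1 : Tendsto (fun y => 1 + e y) (𝓝 (0 : S)) (𝓝 1) := by
      simpa using (e.continuous.tendsto 0).const_add 1
    exact h1.eventually (Units.isOpen.mem_nhds isUnit_one)
  have h0 : j 0 = g := by
    have : unitOf (1 : MatAlg n) = 1 := unitOf_val 1
    rw [hj]; beta_reduce
    rw [map_zero, add_zero, this, mul_one]
  have hjd : MDifferentiableAt 𝓘(ℝ, S) 𝓘(ℝ, S) j 0 := by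
    have h1 : ContDiffAt ℝ ∞ (fun y => 1 + e y) (0 : S) :=
      (contDiff_const.add e.contDiff).contDiffAt
    have h2 : ContMDiffAt 𝓘(ℝ, MatAlg n) (modelG n) ∞ unitOf (1 + e 0 : MatAlg n) :=
      contMDiffOn_unitOf.contMDiffAt (by
        rw [map_zero, add_zero]
        exact Units.isOpenEmbedding_val.isOpen_range.mem_nhds ⟨1, rfl⟩)
    have h3 : ContMDiffAt 𝓘(ℝ, S) (modelG n) ∞ (fun y => unitOf (1 + e y)) (0 : S) :=
      ContMDiffAt.comp (0 : S) h2 h1.contMDiffAt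
    have h4 : ContMDiffAt 𝓘(ℝ, S) (modelG n) ∞ (fun y => g * unitOf (1 + e y)) (0 : S) :=
      ContMDiffAt.comp (0 : S) (contMDiff_mul_left (I := modelG n) (n := ∞) (a := g)).contMDiffAt h3
    exact (ContMDiffAt.comp (0 : S) (h.contMDiff_mk _) h4).mdifferentiableAt (by simp)
  have hφ := (contMDiff_orbitMap hr h).mdifferentiableAt (x := j 0) (by simp)
  rw [← h0]
  refine mfderiv_injective_of_comp hjd hφ ?_
  set Ψ : MatAlg n → Tensor n := fun X => ∑ j : Fin r, outer (cols hr X j)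
  have hcomp : φ ∘ j =ᶠ[𝓝 0] fun y => actionEquiv g (Ψ (1 + e y)) := by
    filter_upwards [hunit] with y hy
    change (g * unitOf (1 + e y)) • baseTensor n r = _
    rw [mul_smul, actionEquiv_apply, smul_baseTensor hr (unitOf (1 + e y))]
    have : comp (unitOf (1 + e y)) = 1 + e y := val_unitOf hy
    rw [this]
    rfl
  have hΨd : HasFDerivAt Ψ (fderiv ℝ Ψ 1) (1 + e 0) := by
    rw [map_zero, add_zero]
    exact ((contDiff_sum_outer_cols (k := 1) hr).differentiable one_ne_zero 1).hasFDerivAt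
  have hF : HasFDerivAt (fun y => actionEquiv g (Ψ (1 + e y)))
      (((actionEquiv g : Tensor n →L[ℝ] Tensor n).comp ((fderiv ℝ Ψ 1).comp e))) (0 : S) :=
    (actionEquiv g : Tensor n →L[ℝ] Tensor n).hasFDerivAt.comp (0 : S)
      (HasFDerivAt.comp (f := fun y => 1 + e y) (0 : S) hΨd (e.hasFDerivAt.const_add 1))
  rw [(hF.congr_of_eventuallyEq hcomp).hasMFDerivAt.mfderiv]
  refine (injective_iff_map_eq_zero
    ((actionEquiv g : Tensor n →L[ℝ] Tensor n).comp ((fderiv ℝ Ψ 1).comp e))).mpr fun y hy => ?_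
  have hy' : fderiv ℝ Ψ 1 (e y) = 0 := (actionEquiv g).map_eq_zero_iff.mp hy
  have := eq_zero_of_fderiv_sum_outer_cols hd hr (he y) hy'
  exact he' (by rw [this, map_zero])

end OrbitMap

/-- Euclidean coordinates on a subspace, extended linearly to the whole space. -/
theorem exists_euclidean_coordinates {V : Type*} [NormedAddCommGroup V] [NormedSpace ℝ V]
    [FiniteDimensional ℝ V] (W : Submodule ℝ V) :
    ∃ (e : EuclideanSpace ℝ (Fin (finrank ℝ W)) →L[ℝ] V)
      (p : V →L[ℝ] EuclideanSpace ℝ (Fin (finrank ℝ W))),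
      (∀ y, e y ∈ W) ∧ (∀ y, p (e y) = y) ∧ ∀ x ∈ W, e (p x) = x := by
  have hdim : finrank ℝ (EuclideanSpace ℝ (Fin (finrank ℝ W))) = finrank ℝ W :=
    finrank_euclideanSpace_fin
  set f := LinearEquiv.ofFinrankEq _ W hdim
  obtain ⟨q, hq⟩ := W.subtype.exists_leftInverse_of_injective W.ker_subtype
  have hq' : ∀ w : W, q w = w := fun w => LinearMap.congr_fun hq w
  refine ⟨LinearMap.toContinuousLinearMap (W.subtype ∘ₗ f.toLinearMap),
    LinearMap.toContinuousLinearMap (f.symm.toLinearMap ∘ₗ q), fun y => (f y).2, fun y => ?_,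
    fun x hx => ?_⟩
  · change f.symm (q (f y : V)) = y
    rw [hq', f.symm_apply_apply]
  · change (f (f.symm (q x)) : V) = x
    rw [f.apply_symm_apply, hq' ⟨x, hx⟩]

end CPTensor

end

theorem mainTheorem1 {d : ℕ} (hd : 3 ≤ d) (n : Fin d → ℕ) (hn : ∀ i, 2 ≤ n i)
    (r : ℕ) (hr : ∀ i, r ≤ n i) :
    -- `Σ_r` is a single orbit, namely that of the base tensor
    CPTensor.SigmaSet n r = MulAction.orbit (CPTensor.G n) (CPTensor.baseTensor n r) ∧
    -- `Σ_r` is open and dense in the set of tensors of CP rank `r`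
    IsOpen ((↑) ⁻¹' CPTensor.SigmaSet n r : Set (CPTensor.rankSet n r)) ∧
    Dense ((↑) ⁻¹' CPTensor.SigmaSet n r : Set (CPTensor.rankSet n r)) ∧
    -- it is even relatively open for the Zariski topology
    (∃ P : Set (MvPolynomial (∀ i, Fin (n i)) ℝ),
      CPTensor.SigmaSet n r =
        {T | T ∈ CPTensor.rankSet n r ∧ ∃ p ∈ P, MvPolynomial.eval T p ≠ 0}) ∧
    -- the stabilizer of the base tensor
    (CPTensor.H n r : Set (CPTensor.G n)) = CPTensor.blockSet hr ∧
    -- `Σ_r` is the smooth homogeneous manifold `G / H`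
    ∃ (m : ℕ) (_ : ChartedSpace (EuclideanSpace ℝ (Fin m)) (CPTensor.G n ⧸ CPTensor.H n r)),
      IsManifold (𝓡 m) ∞ (CPTensor.G n ⧸ CPTensor.H n r) ∧
      ContMDiffSMul (CPTensor.modelG n) (𝓡 m) ∞
        (CPTensor.G n) (CPTensor.G n ⧸ CPTensor.H n r) ∧
      Manifold.IsSubmersion (CPTensor.modelG n) (𝓡 m) ∞
        (QuotientGroup.mk : CPTensor.G n → CPTensor.G n ⧸ CPTensor.H n r) ∧
      (∀ f : CPTensor.G n ⧸ CPTensor.H n r → ℝ,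
        ContMDiff (𝓡 m) 𝓘(ℝ, ℝ) ∞ f ↔
          ContMDiff (CPTensor.modelG n) 𝓘(ℝ, ℝ) ∞
            (fun g : CPTensor.G n => f (QuotientGroup.mk g))) ∧
      Manifold.IsSmoothEmbedding (𝓡 m) 𝓘(ℝ, CPTensor.Tensor n) ∞
        (MulAction.ofQuotientStabilizer (CPTensor.G n) (CPTensor.baseTensor n r)) ∧
      Set.range (MulAction.ofQuotientStabilizer (CPTensor.G n) (CPTensor.baseTensor n r)) =
        CPTensor.SigmaSet n r := by
  have hd' : 2 ≤ d := by omega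
  refine ⟨CPTensor.SigmaSet_eq_orbit hd' hr, CPTensor.isOpen_preimage_SigmaSet,
    CPTensor.dense_preimage_SigmaSet hd' hr, ⟨_, CPTensor.SigmaSet_eq_eval_ne_zero⟩,
    CPTensor.coe_H_eq_blockSet hd hr, ?_⟩
  have i₀ : Fin d := ⟨0, by omega⟩
  obtain ⟨e, p, he, hpe, hep⟩ := CPTensor.exists_euclidean_coordinates (CPTensor.sliceSpace hr i₀)
  set s := CPTensor.standardSlice hd hr i₀ he hpe hep
  let _ := s.chartedSpace
  have hM := s.isManifold
  have hs : CPTensor.HasSmoothSections (CPTensor.modelG n) ∞ (CPTensor.H n r)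
      (EuclideanSpace ℝ (Fin _)) := ⟨s.contMDiff_mk, s.exists_section⟩
  refine ⟨_, s.chartedSpace, hM, hs.contMDiffSMul, ?_, fun f => hs.contMDiff_iff_comp_mk,
    ⟨?_, CPTensor.isEmbedding_orbitMap hd hr⟩, CPTensor.range_orbitMap hd' hr⟩
  · exact Manifold.IsSubmersionOfComplement.isSubmersion fun g =>
      CPTensor.isSubmersionAtOfComplement_of_surjective hs.contMDiff_mk (by simp)
        (hs.mfderiv_mk_surjective (by simp) g)
  · exact Manifold.IsImmersionOfComplement.isImmersion fun x =>
      CPTensor.isImmersionAtOfComplement_of_injective (CPTensor.contMDiff_orbitMap hr hs) (by simp)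
        (CPTensor.mfderiv_orbitMap_injective hd hr hs he
          (Function.LeftInverse.injective hpe) x)
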